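/- Let $G$ be a countable group. Let $\mathcal C$ be the Cantor space, $\mathrm{Homeo}(\mathcal C)$ its group of self-homeomorphisms with the uniform topology, and $\mathrm{Act}_G(\mathcal C)$ the space of continuous actions of $G$ on $\mathcal C$, that is, of homomorphisms $G\to\mathrm{Homeo}(\mathcal C)$, with the topology induced by the product topology on $\mathrm{Homeo}(\mathcal C)^G$. The group $G$ has the strong topological Rokhlin property (STRP) if some $\alpha\in\mathrm{Act}_G(\mathcal C)$ has a comeager conjugacy class $\{\varphi\alpha\varphi^{-1}:\varphi\in\mathrm{Homeo}(\mathcal C)\}$ in $\mathrm{Act}_G(\mathcal C)$. Alphabets are finite discrete sets with at least two elements. A subshift of $A^G$ is a closed subset invariant under the shift $(gx)(h)=x(g^{-1}h)$; $\mathcal S_G(A)$ is the space of all subshifts of $A^G$ with the Vietoris topology. A factor map is a surjective continuous $G$-equivariant map between subshifts, and its range is then a factor of its domain. A subshift $X\subseteq A^G$ is of finite type if there are a finite set $F\subseteq G$ and a set $\mathcal F\subseteq A^F$ such that, for all $x\in A^G$, $x\in X$ if and only if $(gx)\restriction F\in\mathcal F$ for every $g\in G$; it is sofic if it is a factor of a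 subshift of finite type (possibly over another alphabet). For a collection $\mathcal A$ of closed subsets of a subshift $X$, we say that $X$ is $\mathcal A$-minimal if no non-empty proper subshift of $X$ intersects every element of $\mathcal A$. A clopen partition consists of pairwise disjoint non-empty clopen sets. Theorem. $G$ has the STRP if and only if for every alphabet $A$, every sofic subshift $X\subseteq A^G$, every subshift of finite type $Z\subseteq B^G$ (over any alphabet $B$) with a factor map $\phi:Z\to X$, and every open neighborhood $\mathcal N$ of $X$ in $\mathcal S_G(A)$, there are - a sofic subshift $Y\subseteq Z$ with $\phi[Y]\in\mathcal N$, - a subshift of finite type $V\subseteq C^G$, for some alphabet $C$, and a factor map $\psi:V\to Y$, - a clopen partition $\mathcal P$ of $V$ such that $\phi[Y]$ is $\mathcal A$-minimal, where $\mathcal A=\{\phi(\psi(P)):P\in\mathcal P\}$. -/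

import Mathlib

open SymbolicDynamics FullShift

/-! ### Actions on the Cantor space -/

/-- The Cantor space. -/
abbrev CantorSp : Type := ℕ → Bool

/-- The space of continuous actions of `G` on the Cantor space: homomorphisms from `G` to the group
of self-homeomorphisms. -/
def ActionSpace (G : Type*) [Group G] : Type _ := G →* (CantorSp ≃ₜ CantorSp)

/-- The uniform topology on the self-homeomorphisms of the Cantor space, as a subspace of
`C(CantorSp, CantorSp)`, whose compact-open topology is the topology of uniform convergence,
the Cantor space being compact. -/
instance homeoCantorTopology : TopologicalSpace (CantorSp ≃ₜ CantorSp) :=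
  TopologicalSpace.induced (fun h : CantorSp ≃ₜ CantorSp => (⟨h, h.continuous⟩ : C(CantorSp, CantorSp)))
    inferInstance

/-- The topology of the space of actions, as a subspace of the product of copies of the group of
self-homeomorphisms indexed by `G`. -/
instance ActionSpace.topology (G : Type*) [Group G] : TopologicalSpace (ActionSpace G) :=
  TopologicalSpace.induced
    (fun (α : G →* (CantorSp ≃ₜ CantorSp)) (g : G) => α g) Pi.topologicalSpace

/-- The conjugate action `g ↦ φ α(g) φ⁻¹`. -/
def ActionSpace.conj {G : Type*} [Group G] (φ : CantorSp ≃ₜ CantorSp) (α : ActionSpace G) :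
    ActionSpace G :=
  (MulAut.conj φ).toMonoidHom.comp (α : G →* (CantorSp ≃ₜ CantorSp))

/-- The strong topological Rokhlin property: some conjugacy class of actions is comeager. -/
def HasSTRP (G : Type*) [Group G] : Prop :=
  ∃ α : ActionSpace G, (Set.range fun φ : CantorSp ≃ₜ CantorSp => ActionSpace.conj φ α) ∈
    residual (ActionSpace G)

/-! ### Subshifts

A subshift of `A^G` is a term of Mathlib's `MulSubshift A G`: a closed set of configurations
`G → A` that is invariant under the shift. The shift `gx(h) = x(g⁻¹h)` by `g` is
`mulShift g⁻¹ x`. -/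

section Subshifts

variable {G : Type*} [Group G]

/-- The left shift action `gx(h) = x(g⁻¹h)`. -/
def leftShift {A : Type*} (g : G) (x : G → A) : G → A := mulShift g⁻¹ x

theorem leftShift_mem {A : Type*} [TopologicalSpace A] (X : MulSubshift A G) (g : G) {x : G → A}
    (hx : x ∈ X.carrier) : leftShift g x ∈ X.carrier := X.mapsTo g⁻¹ hx

/-- The Vietoris topology on the space of all subshifts of `A^G`. -/
instance subshiftTopology (A : Type*) [TopologicalSpace A] :
    TopologicalSpace (MulSubshift A G) :=
  TopologicalSpace.induced MulSubshift.carrier (TopologicalSpace.vietoris (G → A))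

/-- A subshift is of finite type if it is defined by a set of allowed patterns on a finite
window. -/
def IsSFT {A : Type*} [TopologicalSpace A] (X : MulSubshift A G) : Prop :=
  ∃ (F : Finset G) (allowed : Set (F → A)),
    ∀ x : G → A, x ∈ X.carrier ↔ ∀ g : G, (fun f : F => leftShift g x f) ∈ allowed

/-- A continuous equivariant map between subshifts. -/
structure SubshiftMap {A B : Type*} [TopologicalSpace A] [TopologicalSpace B]
    (X : MulSubshift A G) (Y : MulSubshift B G) where
  /-- The underlying map. -/
  toFun : X.carrier → Y.carrier
  /-- The map is continuous. -/
  continuous_toFun : Continuous toFun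
  /-- The map commutes with the shift actions. -/
  equivariant : ∀ (g : G) (x : X.carrier),
    (toFun ⟨leftShift g x.1, leftShift_mem X g x.2⟩ : G → B) = leftShift g (toFun x).1

/-- A factor map is a surjective continuous equivariant map between subshifts. -/
def SubshiftMap.IsFactorMap {A B : Type*} [TopologicalSpace A] [TopologicalSpace B]
    {X : MulSubshift A G} {Y : MulSubshift B G} (φ : SubshiftMap X Y) : Prop :=
  Function.Surjective φ.toFun

/-- The image `φ[W]` of a subshift `W` of `X` (in general, of `W ∩ X`) under a continuous
equivariant map defined on `X`. -/
def SubshiftMap.image {A B : Type*} [TopologicalSpace A] [Finite A]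
    [TopologicalSpace B] [T2Space B] {X : MulSubshift A G} {Y : MulSubshift B G}
    (φ : SubshiftMap X Y) (W : MulSubshift A G) : MulSubshift B G where
  carrier := (fun x : X.carrier => (φ.toFun x : G → B)) '' {x | (x : G → A) ∈ W.carrier}
  isClosed := by
    have : CompactSpace X.carrier := isCompact_iff_compactSpace.1 X.isClosed.isCompact
    exact ((W.isClosed.preimage continuous_subtype_val).isCompact.image
      (continuous_subtype_val.comp φ.continuous_toFun)).isClosed
  mapsTo := by
    rintro g _ ⟨x, hx, rfl⟩
    refine ⟨⟨leftShift g⁻¹ x.1, leftShift_mem X g⁻¹ x.2⟩, leftShift_mem W g⁻¹ hx, ?_⟩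
    have h := φ.equivariant g⁻¹ x
    simpa only [leftShift, inv_inv] using h

/-- A subshift is sofic if it is a factor of a subshift of finite type over some finite alphabet
with at least two letters. -/
def IsSofic {A : Type*} [TopologicalSpace A] (X : MulSubshift A G) : Prop :=
  ∃ (B : Type) (_ : TopologicalSpace B) (_ : DiscreteTopology B) (_ : Finite B) (_ : Nontrivial B)
    (Z : MulSubshift B G) (φ : SubshiftMap Z X), IsSFT Z ∧ φ.IsFactorMap

/-- `X` is `𝒜`-minimal if no non-empty proper subshift of `X` intersects all elements of `𝒜`. -/
def IsMinimalFor {A : Type*} [TopologicalSpace A] (X : MulSubshift A G)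
    (𝒜 : Set (Set (G → A))) : Prop :=
  ¬ ∃ Y : MulSubshift A G, Y.carrier.Nonempty ∧ Y.carrier ⊂ X.carrier ∧
    ∀ D ∈ 𝒜, (Y.carrier ∩ D).Nonempty

/-- A clopen partition of `V`: pairwise disjoint non-empty clopen sets that cover `V`. -/
def IsClopenPartition {A : Type*} [TopologicalSpace A] (V : MulSubshift A G)
    (P : Set (Set V.carrier)) : Prop :=
  Setoid.IsPartition P ∧ ∀ p ∈ P, IsClopen p

end Subshifts

/-!
An action `α` on the Cantor space and a continuous labelling `p` of the space by finitely many
letters determine the subshift of itineraries of the points. The proof translates between the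
topology of the space of actions and these subshifts. Two facts make the translation work.

* The windows `windowAt α.act p F` of the labellings `p = firstBits k` give a neighbourhood basis
  at `α` (`ActionSpace.exists_windowAt_of_mem_nhds`).
* Every zero-dimensional system `K` with a labelling that has the same window patterns as `p` is a
  factor of an action in the corresponding neighbourhood, compatibly with the labellings
  (`exists_action_near_with_factor`). Indeed the product of `K` with a Cantor space is a Cantor
  space, and can be identified with the given one so that the windows correspond, by a labelled
  form of Brouwer's theorem (`exists_homeomorph_prod_cantor`).

A subshift `Y` that is a factor of a subshift of finite type `V` and is minimal for the image of a
clopen partition of `V` is isolated in the following sense: every labelling of an action with the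
same window patterns as `V`, for a suitable window, has exactly `Y` as its subshift of images of
itineraries (`exists_window_of_isMinimalFor`).

*The condition implies the STRP.* Only the case of the identity map of a subshift of finite type is
needed. It says that, for every labelling, the actions under which its subshift of itineraries is
isolated in this sense are dense (`dense_isolatedSet`); they also form an open set. If labellings
`p` under `α` and `q` under `β` have the same itineraries, then the fibre product of the two actions
shows that labellings refining `p` whose itineraries are isolated can be copied to labellings
refining `q`, after an arbitrarily small change of `β` (`mem_closure_extensionSet`). For generic `β`
the change is unnecessary. There are countably many requirements, hence comeagerly many generic
actions, and any two of these are conjugate by back-and-forth (`IsGenericAction.exists_conj_eq`).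

*The STRP implies the condition.* Let `q` be a labelling of an action whose itineraries form the
subshift of finite type `Z`. A comeager conjugacy class `{h α h⁻¹}` splits into countably many
pieces according to the labelling `q ∘ h`, and the subshift of itineraries of `q` is constant on
each piece, hence on its closure. By the Baire category theorem, some action close to the given one
has a neighbourhood on which this subshift is constant (`HasSTRP.exists_locally_constant`). The
value is `Y`; the neighbourhood is described by window patterns, which define `V`, and the partition
of `V` by these patterns is the one required (`HasSTRP.exists_minimal`).
-/

section

open Set Topology

/-! ### Locally constant functions of configurations -/

/-- A locally constant function on a closed set of configurations over a finite alphabet is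
determined by finitely many coordinates. -/
theorem exists_finset_forall_eq_of_isLocallyConstant {ι A E : Type*} [TopologicalSpace A]
    [DiscreteTopology A] [Finite A] {S : Set (ι → A)}
    (hS : IsClosed S) {f : S → E} (hf : IsLocallyConstant f) :
    ∃ F : Finset ι, ∀ x y : S, (∀ i ∈ F, x.1 i = y.1 i) → f x = f y := by
  classical
  have hloc : ∀ x : S, ∃ F : Finset ι, ∀ y : S, (∀ i ∈ F, y.1 i = x.1 i) → f y = f x := by
    intro x
    obtain ⟨U, hU, hUf⟩ := isOpen_induced_iff.1 (hf {f x})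
    have hxU : x.1 ∈ U := by
      have : x ∈ Subtype.val ⁻¹' U := by rw [hUf]; rfl
      exact this
    obtain ⟨I, u, hu, hIu⟩ := isOpen_pi_iff.1 hU x.1 hxU
    refine ⟨I, fun y hy => ?_⟩
    have hyU : y ∈ Subtype.val ⁻¹' U := hIu fun i hi => by rw [hy i hi]; exact (hu i hi).2
    rw [hUf] at hyU
    exact hyU
  choose F hF using hloc
  have : CompactSpace S := isCompact_iff_compactSpace.1 hS.isCompact
  obtain ⟨t, ht⟩ := isCompact_univ.elim_finite_subcover
    (fun x : S => Subtype.val ⁻¹' cylinder (F x) x.1)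
    (fun x => (isOpen_cylinder (F x) x.1).preimage continuous_subtype_val)
    (fun x _ => mem_iUnion.2 ⟨x, fun _ _ => rfl⟩)
  refine ⟨t.biUnion F, fun x y hxy => ?_⟩
  obtain ⟨z, hz, hyz⟩ := mem_iUnion₂.1 (ht (mem_univ y))
  rw [hF z y hyz]
  exact hF z x fun i hi => (hxy i (Finset.mem_biUnion.2 ⟨z, hz, hi⟩)).trans (hyz i hi)

/-! ### Back-and-forth between zero-dimensional compact spaces -/

/-- The limit map of a coherent sequence of labellings `P n`, `Q n` with the same itineraries,
when the labellings `Q n` generate the clopen sets. -/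
theorem exists_continuous_of_coherent {ι K L : Type*} [TopologicalSpace K]
    [TopologicalSpace L] [CompactSpace L] [T2Space L] [TotallyDisconnectedSpace L]
    (a : ι → K → K) (b : ι → L → L) (hb : ∀ i, Continuous (b i))
    (i₀ : ι) (ha₀ : ∀ x, a i₀ x = x) (hb₀ : ∀ y, b i₀ y = y)
    (P : ℕ → C(K, ℕ)) (Q : ℕ → C(L, ℕ))
    (hPQ : ∀ n, ∃ π : ℕ → ℕ, (∀ x, P n x = π (P (n + 1) x)) ∧ ∀ y, Q n y = π (Q (n + 1) y))
    (hrange : ∀ n, range (fun x i => P n (a i x)) ⊆ range (fun y i => Q n (b i y)))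
    (hQ : ∀ W : Set L, IsClopen W → ∃ n, ∃ w : Set ℕ, ∀ y, y ∈ W ↔ Q n y ∈ w) :
    ∃ h : K → L, Continuous h ∧ ∀ n i x, Q n (b i (h x)) = P n (a i x) := by
  have hex : ∀ x, ∃ y, ∀ n i, Q n (b i y) = P n (a i x) := by
    intro x
    have := IsCompact.nonempty_iInter_of_sequence_nonempty_isCompact_isClosed
      (fun n => {y | ∀ i, Q n (b i y) = P n (a i x)}) ?_ ?_ ?_ ?_
    · obtain ⟨y, hy⟩ := this
      exact ⟨y, fun n => mem_iInter.1 hy n⟩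
    · intro n y hy i
      obtain ⟨π, h1, h2⟩ := hPQ n
      rw [h1, h2, hy i]
    · intro n
      obtain ⟨y, hy⟩ := hrange n ⟨x, rfl⟩
      exact ⟨y, fun i => congrFun hy i⟩
    · apply IsClosed.isCompact
      simp only [ofPred_forall]
      exact isClosed_iInter fun i =>
        isClosed_eq ((Q 0).continuous.comp (hb i)) continuous_const
    · intro n
      simp only [ofPred_forall]
      exact isClosed_iInter fun i =>
        isClosed_eq ((Q n).continuous.comp (hb i)) continuous_const
  choose h hh using hex
  refine ⟨h, ?_, fun n i x => hh x n i⟩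
  rw [(isTopologicalBasis_isClopen (X := L)).continuous_iff]
  intro W hW
  obtain ⟨n, w, hw⟩ := hQ W hW
  have : h ⁻¹' W = P n ⁻¹' w := by
    ext x
    have := hh x n i₀
    rw [hb₀, ha₀] at this
    rw [mem_preimage, hw, this, mem_preimage]
  rw [this]
  exact (isOpen_discrete w).preimage (P n).continuous

theorem eq_of_forall_isClopen {L : Type*} [TopologicalSpace L] [CompactSpace L] [T2Space L]
    [TotallyDisconnectedSpace L] {x y : L} (h : ∀ W : Set L, IsClopen W → (x ∈ W ↔ y ∈ W)) :
    x = y := by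
  by_contra hne
  obtain ⟨U, hU, hx, hy⟩ := exists_isClopen_of_totally_separated hne
  exact hy ((h U hU).1 hx)

/-- A continuous labelling refining `p` from which membership in the clopen set `U` can be read. -/
noncomputable def refineLabel {K : Type*} [TopologicalSpace K] (p : C(K, ℕ))
    (U : TopologicalSpace.Clopens K) : C(K, ℕ) where
  toFun x := by
    classical
    exact Nat.pair (p x) (if x ∈ U then 1 else 0)
  continuous_toFun := by
    classical
    have h1 : Continuous fun x => if x ∈ U then (1 : ℕ) else 0 := by
      refine Continuous.if (fun x hx => ?_) continuous_const continuous_const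
      have : x ∈ frontier (U : Set K) := hx
      rw [U.isClopen.frontier_eq] at this
      exact this.elim
    exact continuous_of_discreteTopology.comp (f := fun x => (p x, if x ∈ U then (1 : ℕ) else 0))
      (g := fun z : ℕ × ℕ => Nat.pair z.1 z.2) (p.continuous.prodMk h1)

theorem fst_refineLabel {K : Type*} [TopologicalSpace K] (p : C(K, ℕ))
    (U : TopologicalSpace.Clopens K) (x : K) : p x = (Nat.unpair (refineLabel p U x)).1 := by
  simp [refineLabel]

theorem snd_refineLabel {K : Type*} [TopologicalSpace K] (p : C(K, ℕ))
    (U : TopologicalSpace.Clopens K) (x : K) :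
    x ∈ U ↔ (Nat.unpair (refineLabel p U x)).2 = 1 := by
  classical
  simp [refineLabel]

/-- Back-and-forth: if the labellings related by `R` have the same itineraries, and the relation
can be extended to refinements on either side, then related labellings are conjugate. -/
theorem exists_homeomorph_of_backAndForth {ι K L : Type*}
    [TopologicalSpace K] [CompactSpace K] [T2Space K] [TotallyDisconnectedSpace K]
    [SecondCountableTopology K]
    [TopologicalSpace L] [CompactSpace L] [T2Space L] [TotallyDisconnectedSpace L]
    [SecondCountableTopology L]
    (a : ι → K → K) (b : ι → L → L) (ha : ∀ i, Continuous (a i)) (hb : ∀ i, Continuous (b i))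
    (i₀ : ι) (ha₀ : ∀ x, a i₀ x = x) (hb₀ : ∀ y, b i₀ y = y)
    (R : C(K, ℕ) → C(L, ℕ) → Prop)
    (hR : ∀ p q, R p q → range (fun x i => p (a i x)) = range (fun y i => q (b i y)))
    (forth : ∀ p q (p' : C(K, ℕ)) (π : ℕ → ℕ), R p q → (∀ x, p x = π (p' x)) →
      ∃ q', R p' q' ∧ ∀ y, q y = π (q' y))
    (back : ∀ p q (q' : C(L, ℕ)) (π : ℕ → ℕ), R p q → (∀ y, q y = π (q' y)) →
      ∃ p', R p' q' ∧ ∀ x, p x = π (p' x))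
    (p₀ : C(K, ℕ)) (q₀ : C(L, ℕ)) (h₀ : R p₀ q₀) :
    ∃ h : K ≃ₜ L, (∀ x, q₀ (h x) = p₀ x) ∧ ∀ i x, h (a i x) = b i (h x) := by
  have step : ∀ (pq : {pq : C(K, ℕ) × C(L, ℕ) // R pq.1 pq.2}) (U : TopologicalSpace.Clopens K)
      (W : TopologicalSpace.Clopens L), ∃ pq' : {pq : C(K, ℕ) × C(L, ℕ) // R pq.1 pq.2},
      (∃ π : ℕ → ℕ, (∀ x, pq.1.1 x = π (pq'.1.1 x)) ∧ ∀ y, pq.1.2 y = π (pq'.1.2 y)) ∧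
      (∃ u : Set ℕ, ∀ x, x ∈ U ↔ pq'.1.1 x ∈ u) ∧ ∃ w : Set ℕ, ∀ y, y ∈ W ↔ pq'.1.2 y ∈ w := by
    rintro ⟨⟨p, q⟩, hpq⟩ U W
    obtain ⟨q', hq', hqq'⟩ := forth p q (refineLabel p U)
      (fun n => (Nat.unpair n).1) hpq (fst_refineLabel p U)
    obtain ⟨p', hp', hpp'⟩ := back _ q' (refineLabel q' W)
      (fun n => (Nat.unpair n).1) hq' (fst_refineLabel q' W)
    refine ⟨⟨(p', refineLabel q' W), hp'⟩,
      ⟨fun n => (Nat.unpair (Nat.unpair n).1).1, fun x => ?_, fun y => ?_⟩,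
      ⟨{n | (Nat.unpair (Nat.unpair n).1).2 = 1}, fun x => ?_⟩,
      ⟨{n | (Nat.unpair n).2 = 1}, fun y => ?_⟩⟩
    · show p x = _
      rw [fst_refineLabel p U, hpp']
    · show q y = _
      rw [hqq', fst_refineLabel q' W]
    · rw [snd_refineLabel p U, hpp']
      rfl
    · exact snd_refineLabel q' W y
  have : Countable (TopologicalSpace.Clopens K) :=
    TopologicalSpace.Clopens.countable_iff_secondCountable.2 inferInstance
  have : Countable (TopologicalSpace.Clopens L) :=
    TopologicalSpace.Clopens.countable_iff_secondCountable.2 inferInstance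
  obtain ⟨eU, heU⟩ := exists_surjective_nat (TopologicalSpace.Clopens K)
  obtain ⟨eW, heW⟩ := exists_surjective_nat (TopologicalSpace.Clopens L)
  choose nxt hπ hu hw using step
  let s : ℕ → {pq : C(K, ℕ) × C(L, ℕ) // R pq.1 pq.2} := fun n =>
    Nat.rec ⟨(p₀, q₀), h₀⟩ (fun n pq => nxt pq (eU n) (eW n)) n
  have hcoh : ∀ n, ∃ π : ℕ → ℕ, (∀ x, (s n).1.1 x = π ((s (n + 1)).1.1 x)) ∧
      ∀ y, (s n).1.2 y = π ((s (n + 1)).1.2 y) := fun n => hπ (s n) (eU n) (eW n)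
  have hgenK : ∀ U : Set K, IsClopen U → ∃ n, ∃ u : Set ℕ, ∀ x, x ∈ U ↔ (s n).1.1 x ∈ u := by
    intro U hU
    obtain ⟨n, hn⟩ := heU ⟨U, hU⟩
    obtain ⟨u, hu⟩ := hu (s n) (eU n) (eW n)
    rw [hn] at hu
    exact ⟨n + 1, u, fun x => by rw [← hn] at hu; rw [← hu, hn]; rfl⟩
  have hgenL : ∀ W : Set L, IsClopen W → ∃ n, ∃ w : Set ℕ, ∀ y, y ∈ W ↔ (s n).1.2 y ∈ w := by
    intro W hW
    obtain ⟨n, hn⟩ := heW ⟨W, hW⟩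
    obtain ⟨w, hw⟩ := hw (s n) (eU n) (eW n)
    exact ⟨n + 1, w, fun y => by rw [← hw, hn]; rfl⟩
  have hr : ∀ n, range (fun x i => (s n).1.1 (a i x)) = range (fun y i => (s n).1.2 (b i y)) :=
    fun n => hR _ _ (s n).2
  obtain ⟨f, hf, hfe⟩ := exists_continuous_of_coherent a b hb i₀ ha₀ hb₀
    (fun n => (s n).1.1) (fun n => (s n).1.2) hcoh (fun n => (hr n).le) hgenL
  obtain ⟨k, hk, hke⟩ := exists_continuous_of_coherent b a ha i₀ hb₀ ha₀
    (fun n => (s n).1.2) (fun n => (s n).1.1)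
    (fun n => let ⟨π, h1, h2⟩ := hcoh n; ⟨π, h2, h1⟩) (fun n => (hr n).ge) hgenK
  have sepK : ∀ x x', (∀ n, (s n).1.1 x = (s n).1.1 x') → x = x' := fun x x' h =>
    eq_of_forall_isClopen fun U hU => by
      obtain ⟨n, u, hu⟩ := hgenK U hU
      rw [hu, hu, h]
  have sepL : ∀ y y', (∀ n, (s n).1.2 y = (s n).1.2 y') → y = y' := fun y y' h =>
    eq_of_forall_isClopen fun W hW => by
      obtain ⟨n, w, hw⟩ := hgenL W hW
      rw [hw, hw, h]
  have hf0 : ∀ n x, (s n).1.2 (f x) = (s n).1.1 x := fun n x => by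
    have := hfe n i₀ x
    rwa [ha₀, hb₀] at this
  have hk0 : ∀ n y, (s n).1.1 (k y) = (s n).1.2 y := fun n y => by
    have := hke n i₀ y
    rwa [ha₀, hb₀] at this
  refine ⟨⟨⟨f, k, fun x => sepK _ _ fun n => ?_, fun y => sepL _ _ fun n => ?_⟩, hf, hk⟩,
    fun x => hf0 0 x, fun i x => sepL _ _ fun n => ?_⟩
  · rw [hk0, hf0]
  · rw [hf0, hk0]
  · exact (hf0 n _).trans (hfe n i x).symm

/-! ### Labellings of the Cantor space -/

/-- On the product with the Cantor space, every non-empty open set can be mapped continuously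
onto every non-empty finite set. -/
theorem exists_image_eq_of_isOpen_prod {K : Type*} [TopologicalSpace K] {U : Set (K × CantorSp)}
    (hU : IsOpen U) (hne : U.Nonempty) {S : Set ℕ} (hS : S.Finite) (hSne : S.Nonempty) :
    ∃ g : C(K × CantorSp, ℕ), g '' U = S := by
  obtain ⟨⟨k₀, c₀⟩, hkc⟩ := hne
  obtain ⟨I, u, hu, hIu⟩ := isOpen_pi_iff.1
    (hU.preimage (Continuous.prodMk_right k₀ : Continuous fun c : CantorSp => (k₀, c))) c₀ hkc
  have : Fintype S := hS.fintype
  have : Nonempty S := hSne.to_subtype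
  obtain ⟨e⟩ : Nonempty (S ↪ (Fin (Fintype.card S) → Bool)) :=
    Function.Embedding.nonempty_of_card_le (by simpa using Nat.lt_two_pow_self.le)
  -- bits beyond the window `I` are unconstrained by `U`
  let N := I.sup id + 1
  let E : (Fin (Fintype.card S) → Bool) → S := Function.invFun e
  have hE : Function.Surjective E := Function.invFun_surjective e.injective
  refine ⟨⟨fun z => (E fun i => z.2 (N + i) : ℕ), ?_⟩, ?_⟩
  · exact (continuous_of_discreteTopology (f := fun v => (E v : ℕ))).comp
      (continuous_pi fun i => (continuous_apply _).comp continuous_snd)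
  · apply Subset.antisymm
    · rintro _ ⟨z, -, rfl⟩
      exact (E _).2
    · intro m hm
      obtain ⟨v, hv⟩ := hE ⟨m, hm⟩
      let c : CantorSp := fun n => if h : n - N < Fintype.card S ∧ N ≤ n then v ⟨n - N, h.1⟩ else c₀ n
      refine ⟨(k₀, c), hIu fun i hi => ?_, ?_⟩
      · have : i < N := Nat.lt_succ_of_le (Finset.le_sup (f := id) hi)
        have hc : c i = c₀ i := dif_neg fun h => absurd h.2 (not_le.2 this)
        rw [hc]
        exact (hu i hi).2
      · have : (fun i : Fin (Fintype.card S) => c (N + i)) = v := by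
          ext i
          have hi : N + (i : ℕ) - N = i := Nat.add_sub_cancel_left _ _
          have h : N + (i : ℕ) - N < Fintype.card S ∧ N ≤ N + i := 
            ⟨by rw [hi]; exact i.2, Nat.le_add_right _ _⟩
          exact (dif_pos h).trans (congrArg v (Fin.ext hi))
        show (E (fun i : Fin (Fintype.card S) => c (N + i)) : ℕ) = m
        rw [this, hv]

theorem exists_image_eq_of_isOpen {U : Set CantorSp}
    (hU : IsOpen U) (hne : U.Nonempty) {S : Set ℕ} (hS : S.Finite) (hSne : S.Nonempty) :
    ∃ g : C(CantorSp, ℕ), g '' U = S := by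
  obtain ⟨g, hg⟩ := exists_image_eq_of_isOpen_prod (K := Unit)
    (hU.preimage (continuous_snd : Continuous (Prod.snd : Unit × CantorSp → CantorSp)))
    (hne.preimage Prod.snd_surjective) hS hSne
  refine ⟨⟨fun c => g ((), c), by fun_prop⟩, ?_⟩
  rw [← hg]
  ext m
  constructor
  · rintro ⟨c, hc, rfl⟩
    exact ⟨((), c), hc, rfl⟩
  · rintro ⟨⟨_, c⟩, hc, rfl⟩
    exact ⟨c, hc, rfl⟩

/-- The extension step of the back-and-forth for labellings with equal ranges: a refinement of `p` is
copied to a refinement of `q` by mapping each fibre of `q` onto the finite set of refined labels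
over it. -/
theorem exists_refinement_of_range_eq {K L : Type*} [TopologicalSpace K] [CompactSpace K]
    [TopologicalSpace L]
    (hL : ∀ U : Set L, IsOpen U → U.Nonempty → ∀ S : Set ℕ, S.Finite → S.Nonempty →
      ∃ g : C(L, ℕ), g '' U = S)
    {p : C(K, ℕ)} {q : C(L, ℕ)} (hpq : range p = range q) (p' : C(K, ℕ)) (π : ℕ → ℕ)
    (hp' : ∀ x, p x = π (p' x)) :
    ∃ q' : C(L, ℕ), range p' = range q' ∧ ∀ y, q y = π (q' y) := by
  have hfin : (range p').Finite := (isCompact_range p'.continuous).finite_of_discrete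
  have hg : ∀ n, ∃ g : C(L, ℕ), n ∈ range q → g '' (q ⁻¹' {n}) = p' '' (p ⁻¹' {n}) := by
    intro n
    by_cases hn : n ∈ range q
    · obtain ⟨y, hy⟩ := hn
      obtain ⟨x, hx⟩ := hpq.ge ⟨y, hy⟩
      obtain ⟨g, hg⟩ := hL (q ⁻¹' {n}) ((isOpen_discrete _).preimage q.continuous) ⟨y, hy⟩
        (p' '' (p ⁻¹' {n})) (hfin.subset (image_subset_range _ _)) ⟨p' x, x, hx, rfl⟩
      exact ⟨g, fun _ => hg⟩
    · exact ⟨ContinuousMap.const _ 0, fun h => absurd h hn⟩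
  choose g hg using hg
  refine ⟨⟨fun y => g (q y) y, ?_⟩, ?_, fun y => ?_⟩
  · exact (continuous_prod_of_discrete_left (f := fun z : ℕ × L => g z.1 z.2)).2
      (fun n => (g n).continuous) |>.comp (q.continuous.prodMk continuous_id)
  · ext m
    constructor
    · rintro ⟨x, rfl⟩
      obtain ⟨y, hy, hy'⟩ := (hg (p x) (hpq.le ⟨x, rfl⟩)).ge ⟨x, rfl, rfl⟩
      refine ⟨y, ?_⟩
      rw [mem_preimage, mem_singleton_iff] at hy
      show g (q y) y = _
      rw [hy, hy']
    · rintro ⟨y, rfl⟩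
      obtain ⟨x, hx, hx'⟩ := (hg (q y) ⟨y, rfl⟩).le ⟨y, rfl, rfl⟩
      exact ⟨x, hx'⟩
  · obtain ⟨x, hx, hx'⟩ := (hg (q y) ⟨y, rfl⟩).le ⟨y, rfl, rfl⟩
    show q y = π (g (q y) y)
    rw [← hx', ← hp']
    exact hx.symm

/-- A labelled form of Brouwer's characterization of the Cantor space. -/
theorem exists_homeomorph_prod_cantor {K : Type*}
    [TopologicalSpace K] [CompactSpace K] [T2Space K] [TotallyDisconnectedSpace K]
    [SecondCountableTopology K] (u : C(K × CantorSp, ℕ)) (w : C(CantorSp, ℕ))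
    (huw : range u = range w) :
    ∃ h : K × CantorSp ≃ₜ CantorSp, ∀ x, w (h x) = u x := by
  have key := exists_homeomorph_of_backAndForth (ι := Unit)
    (fun _ x => x) (fun _ x => x) (fun _ => continuous_id) (fun _ => continuous_id)
    () (fun _ => rfl) (fun _ => rfl) (fun (p : C(K × CantorSp, ℕ)) (q : C(CantorSp, ℕ)) =>
      range p = range q) ?_ ?_ ?_ u w huw
  · exact key.imp fun _ h => h.1
  · intro p q hpq
    have := congrArg (fun S => (fun (n : ℕ) (_ : Unit) => n) '' S) hpq
    rwa [← range_comp, ← range_comp] at this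
  · intro p q p' π hpq hp
    exact exists_refinement_of_range_eq (fun U hU hne S hS hSne =>
      exists_image_eq_of_isOpen hU hne hS hSne) hpq p' π hp
  · intro p q q' π hpq hq
    obtain ⟨p', h1, h2⟩ := exists_refinement_of_range_eq (fun U hU hne S hS hSne =>
      exists_image_eq_of_isOpen_prod hU hne hS hSne) hpq.symm q' π hq
    exact ⟨p', h1.symm, h2⟩

/-! ### Itineraries -/

/-- The axioms of an action of `G` on a topological space `K` by continuous maps. -/
structure IsContinuousAction {G K : Type*} [Group G] [TopologicalSpace K] (a : G → K → K) :
    Prop where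
  one : ∀ x, a 1 x = x
  mul : ∀ g h x, a (g * h) x = a g (a h x)
  continuous : ∀ g, Continuous (a g)

/-- The itinerary of the point `x` under the action `a`, with respect to the labelling `p`: its
entry at `g` is the label of `g⁻¹x`, so that the itinerary map is equivariant for the left shift. -/
def itinerary {G K A : Type*} [Group G] (a : G → K → K) (p : K → A) (x : K) : G → A :=
  fun g => p (a g⁻¹ x)

/-- The restriction of the itinerary of `x` to the finite window `F`. -/
def windowAt {G K A : Type*} [Group G] (a : G → K → K) (p : K → A) (F : Finset G) (x : K) :
    F → A :=
  fun g => itinerary a p x g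

/-- The homomorphism underlying an action. -/
def ActionSpace.toHom {G : Type*} [Group G] (α : ActionSpace G) : G →* (CantorSp ≃ₜ CantorSp) := α

/-- The maps of an action of `G` on the Cantor space. -/
def ActionSpace.act {G : Type*} [Group G] (α : ActionSpace G) (g : G) : CantorSp → CantorSp :=
  α.toHom g

section Itinerary

variable {G : Type*} [Group G]

theorem ActionSpace.isContinuousAction (α : ActionSpace G) : IsContinuousAction α.act where
  one x := by
    show (α.toHom 1) x = x
    rw [map_one]; rfl
  mul g h x := by
    show (α.toHom (g * h)) x = _
    rw [map_mul]; rfl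
  continuous g := (α.toHom g).continuous

theorem ActionSpace.act_conj (φ : CantorSp ≃ₜ CantorSp) (α : ActionSpace G) (g : G)
    (x : CantorSp) : (ActionSpace.conj φ α).act g (φ x) = φ (α.act g x) := by
  show (φ * α.toHom g * φ⁻¹) (φ x) = _
  show φ (α.toHom g (φ.symm (φ x))) = _
  rw [Homeomorph.symm_apply_apply]; rfl

theorem ActionSpace.ext_act {α β : ActionSpace G} (h : ∀ g x, α.act g x = β.act g x) : α = β :=
  MonoidHom.ext fun g => Homeomorph.ext fun x => h g x

variable {K L A : Type*} {a : G → K → K} {b : G → L → L}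

theorem IsContinuousAction.inv_apply [TopologicalSpace K] (ha : IsContinuousAction a) (g : G) (x : K) :
    a g⁻¹ (a g x) = x := by
  rw [← ha.mul, inv_mul_cancel, ha.one]

theorem IsContinuousAction.apply_inv [TopologicalSpace K] (ha : IsContinuousAction a) (g : G) (x : K) :
    a g (a g⁻¹ x) = x := by
  rw [← ha.mul, mul_inv_cancel, ha.one]

theorem itinerary_one [TopologicalSpace K] (ha : IsContinuousAction a) (p : K → A) (x : K) :
    itinerary a p x 1 = p x := by
  simp [itinerary, ha.one]

theorem itinerary_act [TopologicalSpace K] (ha : IsContinuousAction a) (p : K → A) (g : G) (x : K) :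
    itinerary a p (a g x) = leftShift g (itinerary a p x) := by
  ext h
  simp [itinerary, leftShift, mulShift, ha.mul]

theorem continuous_itinerary [TopologicalSpace K] [TopologicalSpace A] (ha : IsContinuousAction a) {p : K → A}
    (hp : Continuous p) : Continuous (itinerary a p) :=
  continuous_pi fun g => hp.comp (ha.continuous g⁻¹)

theorem continuous_windowAt [TopologicalSpace K] [TopologicalSpace A] (ha : IsContinuousAction a) {p : K → A}
    (hp : Continuous p) (F : Finset G) : Continuous (windowAt a p F) :=
  continuous_pi fun _ => hp.comp (ha.continuous _)

theorem itinerary_comp {s : K → L} (hs : ∀ g x, s (a g x) = b g (s x)) (p : L → A) (x : K) :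
    itinerary a (p ∘ s) x = itinerary b p (s x) := by
  ext g
  simp [itinerary, hs]

theorem windowAt_comp {s : K → L} (hs : ∀ g x, s (a g x) = b g (s x)) (p : L → A) (F : Finset G)
    (x : K) : windowAt a (p ∘ s) F x = windowAt b p F (s x) := by
  ext g
  simp [windowAt, itinerary, hs]

theorem range_itinerary_comp {s : K → L} (hs : ∀ g x, s (a g x) = b g (s x))
    (hsurj : Function.Surjective s) (p : L → A) :
    range (itinerary a (p ∘ s)) = range (itinerary b p) := by
  have : itinerary a (p ∘ s) = itinerary b p ∘ s := funext fun x => itinerary_comp hs p x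
  rw [this, hsurj.range_comp]

theorem range_windowAt_comp {s : K → L} (hs : ∀ g x, s (a g x) = b g (s x))
    (hsurj : Function.Surjective s) (p : L → A) (F : Finset G) :
    range (windowAt a (p ∘ s) F) = range (windowAt b p F) := by
  have : windowAt a (p ∘ s) F = windowAt b p F ∘ s := funext fun x => windowAt_comp hs p F x
  rw [this, hsurj.range_comp]

end Itinerary

/-! ### The topology of the space of actions -/

section Topology

variable {G : Type*} [Group G]

/-- The first `k` coordinates of a point of the Cantor space. -/
def firstBits (k : ℕ) (x : CantorSp) : Fin k → Bool := fun i => x i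

theorem continuous_firstBits (k : ℕ) : Continuous (firstBits k) :=
  continuous_pi fun _ => continuous_apply _

/-- Every continuous labelling of the Cantor space depends on finitely many coordinates. -/
theorem exists_eq_comp_firstBits {E : Type*} [TopologicalSpace E] [DiscreteTopology E]
    {p : CantorSp → E} (hp : Continuous p) :
    ∃ k₀, ∀ k, k₀ ≤ k → ∃ π : (Fin k → Bool) → E, p = π ∘ firstBits k := by
  obtain ⟨F, hF⟩ := exists_finset_forall_eq_of_isLocallyConstant (S := (univ : Set CantorSp))
    (f := fun x => p x.1) isClosed_univ
    ((IsLocallyConstant.iff_continuous _).2 (hp.comp continuous_subtype_val))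
  refine ⟨F.sup id + 1, fun k hk => ?_⟩
  refine ⟨fun v => p fun n => if h : n < k then v ⟨n, h⟩ else false, funext fun x => ?_⟩
  refine hF ⟨x, mem_univ _⟩ ⟨_, mem_univ _⟩ fun i hi => ?_
  have : i < k := (Nat.lt_succ_of_le (Finset.le_sup (f := id) hi)).trans_le hk
  show x i = dite (i < k) (fun h => firstBits k x ⟨i, h⟩) (fun _ => false)
  rw [dif_pos this]
  rfl

theorem isOpen_setOf_forall_comp_eq {X Y A : Type*} [TopologicalSpace X] [CompactSpace X]
    [TopologicalSpace Y] [TopologicalSpace A] [DiscreteTopology A] {p : Y → A} (hp : Continuous p)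
    {f : X → A} (hf : Continuous f) : IsOpen {h : C(X, Y) | ∀ x, p (h x) = f x} := by
  have hfin : (range f).Finite := (isCompact_range hf).finite_of_discrete
  have : {h : C(X, Y) | ∀ x, p (h x) = f x} =
      ⋂ c ∈ range f, {h : C(X, Y) | MapsTo h (f ⁻¹' {c}) (p ⁻¹' {c})} := by
    ext h
    simp only [mem_ofPred_eq, mem_iInter]
    constructor
    · intro H c _ x hx
      exact (H x).trans hx
    · intro H x
      exact H (f x) ⟨x, rfl⟩ (rfl : f x = f x)
  rw [this]
  exact hfin.isOpen_biInter fun c _ => ContinuousMap.isOpen_setOfPred_mapsTo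
    ((isClosed_discrete {c}).preimage hf).isCompact ((isOpen_discrete {c}).preimage hp)

theorem exists_firstBits_of_mem_nhds {f : C(CantorSp, CantorSp)} {V : Set C(CantorSp, CantorSp)}
    (hV : V ∈ 𝓝 f) : ∃ k₀, ∀ k, k₀ ≤ k → ∀ h : C(CantorSp, CantorSp),
      (∀ x, firstBits k (h x) = firstBits k (f x)) → h ∈ V := by
  have hone : ∃ k, ∀ h : C(CantorSp, CantorSp),
      (∀ x, firstBits k (h x) = firstBits k (f x)) → h ∈ V := by
    by_contra! hcon
    choose h hh hV' using hcon
    have hlim : Filter.Tendsto h Filter.atTop (𝓝 f) := by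
      rw [ContinuousMap.tendsto_iff_tendstoUniformly, tendstoUniformly_iff_tendsto, Pi.uniformity,
        Filter.tendsto_iInf]
      intro i
      rw [Filter.tendsto_comap_iff]
      refine (Filter.tendsto_principal.2 ?_ : Filter.Tendsto _ _ (Filter.principal
        SetRel.id)).mono_right refl_le_uniformity
      refine ((Filter.eventually_gt_atTop i).prod_inl _).mono fun q hq => ?_
      exact (congrFun (hh q.1 q.2) ⟨i, hq⟩).symm
    obtain ⟨k, hk⟩ := (hlim.eventually_mem hV).exists
    exact hV' k hk
  obtain ⟨k₀, hk₀⟩ := hone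
  refine ⟨k₀, fun k hk h H => hk₀ h fun x => funext fun i => ?_⟩
  exact congrFun (H x) ⟨i, i.2.trans_le hk⟩

/-- The maps of an action as elements of a product of spaces of continuous maps. -/
def ActionSpace.toMaps (α : ActionSpace G) (g : G) : C(CantorSp, CantorSp) :=
  ⟨α.act g, α.isContinuousAction.continuous g⟩

theorem ActionSpace.isInducing_toMaps :
    IsInducing (ActionSpace.toMaps : ActionSpace G → G → C(CantorSp, CantorSp)) := by
  have h1 : IsInducing (fun (α : ActionSpace G) (g : G) =>
      α.toHom g) := ⟨rfl⟩
  have h2 : IsInducing (fun h : CantorSp ≃ₜ CantorSp =>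
      (⟨h, h.continuous⟩ : C(CantorSp, CantorSp))) := ⟨rfl⟩
  exact (IsInducing.piMap fun _ : G => h2).comp h1

theorem ActionSpace.isOpen_setOf_windowAt_eq {A : Type*} [TopologicalSpace A] [DiscreteTopology A]
    (α : ActionSpace G) {p : CantorSp → A} (hp : Continuous p) (F : Finset G) :
    IsOpen {β : ActionSpace G | ∀ x, windowAt β.act p F x = windowAt α.act p F x} := by
  have : {β : ActionSpace G | ∀ x, windowAt β.act p F x = windowAt α.act p F x} =
      ⋂ g ∈ F, (fun β : ActionSpace G => β.toMaps g⁻¹) ⁻¹'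
        {h : C(CantorSp, CantorSp) | ∀ x, p (h x) = p (α.act g⁻¹ x)} := by
    ext β
    simp only [mem_ofPred_eq, mem_iInter, mem_preimage]
    constructor
    · intro H g hg x
      exact congrFun (H x) ⟨g, hg⟩
    · intro H x
      ext g
      exact H g g.2 x
  rw [this]
  refine isOpen_biInter_finset fun g _ => (isOpen_setOf_forall_comp_eq hp
    (hp.comp (α.isContinuousAction.continuous g⁻¹))).preimage ?_
  exact (continuous_apply _).comp ActionSpace.isInducing_toMaps.continuous

/-- Prescribing the windows of the labelling by the first `k` bits gives a neighbourhood basis. -/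
theorem ActionSpace.exists_windowAt_of_mem_nhds {α : ActionSpace G} {U : Set (ActionSpace G)}
    (hU : U ∈ 𝓝 α) : ∃ (k₀ : ℕ) (F₀ : Finset G), ∀ k F, k₀ ≤ k → F₀ ⊆ F → ∀ β : ActionSpace G,
      (∀ x, windowAt β.act (firstBits k) F x = windowAt α.act (firstBits k) F x) → β ∈ U := by
  classical
  rw [ActionSpace.isInducing_toMaps.nhds_eq_comap, Filter.mem_comap] at hU
  obtain ⟨T, hT, hTU⟩ := hU
  rw [nhds_pi, Filter.mem_pi] at hT
  obtain ⟨I, hI, t, ht, htT⟩ := hT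
  choose k₀ hk₀ using fun g => exists_firstBits_of_mem_nhds (ht g)
  refine ⟨hI.toFinset.sup k₀, hI.toFinset.image (·⁻¹), fun k F hk hF β hβ => hTU (htT ?_)⟩
  intro g hg
  have hg' : g ∈ hI.toFinset := hI.mem_toFinset.2 hg
  refine hk₀ g k ((Finset.le_sup hg').trans hk) _ fun x => ?_
  have := congrFun (hβ x) ⟨g⁻¹, hF (Finset.mem_image_of_mem _ hg')⟩
  simp only [windowAt, itinerary, inv_inv] at this
  exact this

/-- An action is the same as a family of continuous maps satisfying the closed conditions
`f 1 = id` and `f (g * h) = f g ∘ f h`. -/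
theorem ActionSpace.isClosedEmbedding_toMaps :
    IsClosedEmbedding (ActionSpace.toMaps : ActionSpace G → G → C(CantorSp, CantorSp)) := by
  refine ⟨⟨ActionSpace.isInducing_toMaps, fun α β h => ActionSpace.ext_act fun g x =>
    DFunLike.congr_fun (congrFun h g) x⟩, ?_⟩
  have : range (ActionSpace.toMaps : ActionSpace G → G → C(CantorSp, CantorSp)) =
      {f | f 1 = ContinuousMap.id _} ∩ ⋂ (g : G) (h : G), {f | f (g * h) = (f g).comp (f h)} := by
    ext f
    constructor
    · rintro ⟨α, rfl⟩
      refine ⟨ContinuousMap.ext α.isContinuousAction.one, mem_iInter₂.2 fun g h => ?_⟩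
      exact ContinuousMap.ext (α.isContinuousAction.mul g h)
    · rintro ⟨h1, h2⟩
      have h1 : f 1 = ContinuousMap.id _ := h1
      have h2 : ∀ g h, f (g * h) = (f g).comp (f h) := fun g h => mem_iInter₂.1 h2 g h
      have hinv : ∀ g x, f g⁻¹ (f g x) = x := fun g x => by
        rw [← ContinuousMap.comp_apply, ← h2, inv_mul_cancel, h1]; rfl
      refine ⟨({ toFun := fun g => ⟨⟨f g, f g⁻¹, hinv g, fun x => by
                  have := hinv g⁻¹ x
                  rwa [inv_inv] at this⟩, (f g).continuous, (f g⁻¹).continuous⟩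
                 map_one' := Homeomorph.ext fun x => DFunLike.congr_fun h1 x
                 map_mul' := fun g h => Homeomorph.ext fun x => DFunLike.congr_fun (h2 g h) x } :
                G →* (CantorSp ≃ₜ CantorSp)), rfl⟩
  rw [this]
  refine (isClosed_eq (continuous_apply _) continuous_const).inter
    (isClosed_iInter fun g => isClosed_iInter fun h => isClosed_eq (continuous_apply _) ?_)
  exact ContinuousMap.continuous_comp'.comp (f := fun f : G → C(CantorSp, CantorSp) => (f h, f g))
    ((continuous_apply h).prodMk (continuous_apply g))

instance ActionSpace.baireSpace [Countable G] : BaireSpace (ActionSpace G) := by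
  have : (uniformity Bool).IsCountablyGenerated := Filter.isCountablyGenerated_principal _
  have : TopologicalSpace.IsCompletelyPseudoMetrizableSpace (G → C(CantorSp, CantorSp)) :=
    inferInstance
  have : TopologicalSpace.IsCompletelyPseudoMetrizableSpace (ActionSpace G) :=
    ActionSpace.isClosedEmbedding_toMaps.IsCompletelyPseudoMetrizableSpace
  infer_instance

instance ActionSpace.nonempty : Nonempty (ActionSpace G) := ⟨(1 : G →* (CantorSp ≃ₜ CantorSp))⟩

/-- Every zero-dimensional system `K` with the right window patterns is a factor of an action on
the Cantor space, arbitrarily close to the given one: multiply `K` by a Cantor space on which `G`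
acts trivially, and identify the product with the Cantor space compatibly with the windows. -/
theorem exists_action_near_with_factor {K A : Type*}
    [TopologicalSpace K] [CompactSpace K] [T2Space K] [TotallyDisconnectedSpace K]
    [SecondCountableTopology K] [TopologicalSpace A] [DiscreteTopology A] [Finite A]
    {a : G → K → K} (ha : IsContinuousAction a) {q : K → A} (hq : Continuous q)
    (α : ActionSpace G) {p : CantorSp → A} (hp : Continuous p) {F : Finset G} (hF : 1 ∈ F)
    (hwin : range (windowAt a q F) = range (windowAt α.act p F)) :
    ∃ (γ : ActionSpace G) (s : CantorSp → K), Continuous s ∧ Function.Surjective s ∧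
      (∀ g x, s (γ.act g x) = a g (s x)) ∧ (∀ x, q (s x) = p x) ∧
      ∀ x, windowAt γ.act p F x = windowAt α.act p F x := by
  obtain ⟨e, he⟩ : ∃ e : (F → A) → ℕ, Function.Injective e := Countable.exists_injective_nat _
  have hcu : Continuous fun z : K × CantorSp => e (windowAt a q F z.1) :=
    continuous_of_discreteTopology.comp ((continuous_windowAt ha hq F).comp continuous_fst)
  have hcw : Continuous fun x : CantorSp => e (windowAt α.act p F x) :=
    continuous_of_discreteTopology.comp (continuous_windowAt α.isContinuousAction hp F)
  obtain ⟨h, hh⟩ := exists_homeomorph_prod_cantor ⟨_, hcu⟩ ⟨_, hcw⟩ (by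
    have h1 : range (fun z : K × CantorSp => e (windowAt a q F z.1)) =
        e '' range (windowAt a q F) := by
      rw [← range_comp, ← (Prod.fst_surjective (β := CantorSp)).range_comp
        (e ∘ windowAt a q F)]
      rfl
    have h2 : range (fun x : CantorSp => e (windowAt α.act p F x)) =
        e '' range (windowAt α.act p F) := by
      rw [← range_comp]; rfl
    exact h1.trans ((congrArg (e '' ·) hwin).trans h2.symm))
  have hw : ∀ z, windowAt α.act p F (h z) = windowAt a q F z.1 := fun z => he (hh z)
  have hpq : ∀ z, p (h z) = q z.1 := fun z => by
    have := congrFun (hw z) ⟨1, hF⟩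
    simpa [windowAt, itinerary_one α.isContinuousAction, itinerary_one ha] using this
  let act' : G → CantorSp ≃ₜ CantorSp := fun g =>
    ⟨⟨fun x => h (a g (h.symm x).1, (h.symm x).2), fun x => h (a g⁻¹ (h.symm x).1, (h.symm x).2),
      fun x => by simp [ha.inv_apply], fun x => by simp [ha.apply_inv]⟩,
      by have := ha.continuous g; fun_prop, by have := ha.continuous g⁻¹; fun_prop⟩
  let γ : G →* (CantorSp ≃ₜ CantorSp) :=
    { toFun := act'
      map_one' := Homeomorph.ext fun x => by
        show h (a 1 (h.symm x).1, (h.symm x).2) = x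
        rw [ha.one]; exact h.apply_symm_apply x
      map_mul' := fun g k => Homeomorph.ext fun x => by
        show h (a (g * k) (h.symm x).1, (h.symm x).2) =
          h (a g (h.symm (h (a k (h.symm x).1, (h.symm x).2))).1,
            (h.symm (h (a k (h.symm x).1, (h.symm x).2))).2)
        rw [h.symm_apply_apply, ha.mul] }
  have hs : ∀ g x, (h.symm (ActionSpace.act (γ : ActionSpace G) g x)).1 = a g (h.symm x).1 :=
    fun g x => by
      show (h.symm (h (a g (h.symm x).1, (h.symm x).2))).1 = _
      rw [h.symm_apply_apply]
  have hqs : ∀ x, q (h.symm x).1 = p x := fun x => by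
    rw [← hpq, h.apply_symm_apply]
  refine ⟨γ, fun x => (h.symm x).1, by fun_prop, ?_, hs, hqs, fun x => ?_⟩
  · exact fun y => ⟨h (y, fun _ => false), by simp⟩
  · have : p = q ∘ fun x => (h.symm x).1 := funext fun x => (hqs x).symm
    conv_lhs => rw [this]
    rw [windowAt_comp (b := a) hs, ← hw, h.apply_symm_apply]

end Topology

/-! ### Subshifts as systems -/

section Subshift

variable {G : Type*} [Group G]

/-- The shift action on a subshift. -/
def shiftAct {A : Type*} [TopologicalSpace A] (V : MulSubshift A G) (g : G) (v : V.carrier) :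
    V.carrier :=
  ⟨leftShift g v.1, leftShift_mem V g v.2⟩

theorem leftShift_one {A : Type*} (x : G → A) : leftShift 1 x = x := by
  simp [leftShift]

theorem isContinuousAction_shiftAct {A : Type*} [TopologicalSpace A] (V : MulSubshift A G) :
    IsContinuousAction (shiftAct V) where
  one v := Subtype.ext (leftShift_one v.1)
  mul g h v := Subtype.ext (by simp [shiftAct, leftShift, mulShift_mul])
  continuous g :=
    ((continuous_mulShift g⁻¹).comp continuous_subtype_val).subtype_mk _

theorem itinerary_shiftAct {A C : Type*} [TopologicalSpace A] [TopologicalSpace C]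
    {V : MulSubshift C G} {Y : MulSubshift A G} (ψ : SubshiftMap V Y) (v : V.carrier) :
    itinerary (shiftAct V) (fun v => (ψ.toFun v).1 1) v = (ψ.toFun v).1 := by
  ext g
  show (ψ.toFun ⟨leftShift g⁻¹ v.1, _⟩).1 1 = _
  rw [ψ.equivariant]
  simp [leftShift]

theorem itinerary_shiftAct_one {A : Type*} [TopologicalSpace A] {V : MulSubshift A G}
    (v : V.carrier) : itinerary (shiftAct V) (fun v => v.1 1) v = v.1 := by
  ext g
  simp [itinerary, shiftAct, leftShift]

/-- The subshift of all itineraries of a system with respect to a continuous labelling. -/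
def itinerarySubshift {K A : Type*} [TopologicalSpace K] [CompactSpace K] [TopologicalSpace A]
    [T2Space A] {a : G → K → K} (ha : IsContinuousAction a) {p : K → A} (hp : Continuous p) :
    MulSubshift A G where
  carrier := range (itinerary a p)
  isClosed := (isCompact_range (continuous_itinerary ha hp)).isClosed
  mapsTo := by
    rintro g _ ⟨x, rfl⟩
    refine ⟨a g⁻¹ x, ?_⟩
    rw [itinerary_act ha, leftShift, inv_inv]

/-- The subshift of finite type of all configurations whose `F`-windows belong to `𝓕`. -/
def ofPatterns {A : Type*} [TopologicalSpace A] [DiscreteTopology A] (F : Finset G)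
    (𝓕 : Set (F → A)) : MulSubshift A G where
  carrier := {x | ∀ g : G, (fun f : F => leftShift g x f) ∈ 𝓕}
  isClosed := by
    rw [ofPred_forall]
    refine isClosed_iInter fun g => (isClosed_discrete 𝓕).preimage ?_
    exact continuous_pi fun f => continuous_apply _
  mapsTo := by
    intro g x hx h
    have := hx (h * g⁻¹)
    convert this using 2
    simp [leftShift, mulShift, mul_assoc]

theorem isSFT_ofPatterns {A : Type*} [TopologicalSpace A] [DiscreteTopology A] (F : Finset G)
    (𝓕 : Set (F → A)) : IsSFT (ofPatterns F 𝓕) :=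
  ⟨F, 𝓕, fun _ => Iff.rfl⟩

theorem itinerary_mem_of_range_windowAt_subset {K A : Type*} [TopologicalSpace K]
    {a : G → K → K} (ha : IsContinuousAction a) {p : K → A} {F : Finset G} {𝓕 : Set (F → A)}
    (h : range (windowAt a p F) ⊆ 𝓕) (x : K) (g : G) :
    (fun f : F => leftShift g (itinerary a p x) f) ∈ 𝓕 := by
  rw [← itinerary_act ha]
  exact h ⟨a g x, rfl⟩

end Subshift

/-! ### Labellings with isolated itineraries -/

section Isolation

variable {G : Type*} [Group G]

/-- The set `𝓕` of patterns isolates the local rule `σ`: whenever the `F`-windows of a labelling of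
an action are exactly the patterns in `𝓕`, the subshift of itineraries of the labelling obtained by
applying `σ` to the windows is the same. -/
def IsIsolating {C E : Type*} [TopologicalSpace C] (F : Finset G) (𝓕 : Set (F → C))
    (σ : (F → C) → E) : Prop :=
  ∀ (γ₁ γ₂ : ActionSpace G) (p₁ p₂ : CantorSp → C), Continuous p₁ → Continuous p₂ →
    range (windowAt γ₁.act p₁ F) = 𝓕 → range (windowAt γ₂.act p₂ F) = 𝓕 →
    range (itinerary γ₁.act (σ ∘ windowAt γ₁.act p₁ F)) =
      range (itinerary γ₂.act (σ ∘ windowAt γ₂.act p₂ F))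

/-- If a factor `ψ : V → Y` of a subshift of finite type is minimal for the image of a clopen
partition of `V`, then a window `F` large enough to see the partition and to compute `ψ` isolates
`Y`: the itineraries of a labelling with the `F`-patterns of `V` form a subshift of `V` that
intersects each piece of the partition, so that its image is all of `Y`. -/
theorem exists_window_of_isMinimalFor {A C E : Type*} [TopologicalSpace A] [DiscreteTopology A]
    [TopologicalSpace C] [DiscreteTopology C] [Finite C] [Nonempty E]
    {V : MulSubshift C G} {Y : MulSubshift A G} (ψ : SubshiftMap V Y) {P : Set (Set V.carrier)}
    (hV : IsSFT V) (hP : IsClopenPartition V P)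
    (hmin : IsMinimalFor Y ((fun p : Set V.carrier => (fun v => (ψ.toFun v : G → A)) '' p) '' P))
    (π : A → E) :
    ∃ (F : Finset G) (σ : (F → C) → E),
      (∀ v : V.carrier, σ (fun f => v.1 f) = π ((ψ.toFun v).1 1)) ∧
      ∀ (γ : ActionSpace G) (p : CantorSp → C), Continuous p →
        range (windowAt γ.act p F) = range (fun (v : V.carrier) (f : F) => v.1 f) →
        range (itinerary γ.act (σ ∘ windowAt γ.act p F)) = (fun y => π ∘ y) '' Y.carrier := by
  classical
  obtain ⟨F₀, allowed, hF₀⟩ := hV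
  obtain ⟨F₁, hF₁⟩ := exists_finset_forall_eq_of_isLocallyConstant V.isClosed
    (f := fun v => (ψ.toFun v).1 1) ((IsLocallyConstant.iff_continuous _).2
      ((continuous_apply 1).comp (continuous_subtype_val.comp ψ.continuous_toFun)))
  choose c hc hcu using hP.1.2
  have hcl : IsLocallyConstant c := (IsLocallyConstant.iff_exists_open c).2 fun v =>
    ⟨c v, (hP.2 _ (hc v).1).isOpen, (hc v).2, fun w hw => (hcu w _ ⟨(hc v).1, hw⟩).symm⟩
  obtain ⟨F₂, hF₂⟩ := exists_finset_forall_eq_of_isLocallyConstant V.isClosed hcl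
  let F := F₀ ∪ F₁ ∪ F₂
  have h0 : F₀ ⊆ F := fun g hg => Finset.mem_union_left _ (Finset.mem_union_left _ hg)
  have h1 : F₁ ⊆ F := fun g hg => Finset.mem_union_left _ (Finset.mem_union_right _ hg)
  have h2 : F₂ ⊆ F := fun g hg => Finset.mem_union_right _ hg
  obtain ⟨σ, hσ⟩ := (Function.factorsThrough_iff (f := fun (v : V.carrier) (f : F) => v.1 f)
    (fun v : V.carrier => π ((ψ.toFun v).1 1))).1 fun v w hvw =>
      congrArg π (hF₁ v w fun i hi => congrFun hvw ⟨i, h1 hi⟩)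
  have hσ' : ∀ v : V.carrier, σ (fun f => v.1 f) = π ((ψ.toFun v).1 1) := fun v =>
    (congrFun hσ v).symm
  refine ⟨F, σ, hσ', fun γ p hp hrange => ?_⟩
  have hγ := γ.isContinuousAction
  have hmem : ∀ x, itinerary γ.act p x ∈ V.carrier := by
    intro x
    rw [hF₀]
    refine itinerary_mem_of_range_windowAt_subset hγ ?_ x
    rintro _ ⟨x, rfl⟩
    obtain ⟨v, hv⟩ := hrange.le ⟨x, rfl⟩
    have : windowAt γ.act p F₀ x = fun f : F₀ => leftShift 1 v.1 f := by
      ext f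
      rw [leftShift_one]
      exact (congrFun hv ⟨f.1, h0 f.2⟩).symm
    rw [this]
    exact (hF₀ v.1).1 v.2 1
  let t : CantorSp → V.carrier := fun x => ⟨itinerary γ.act p x, hmem x⟩
  have ht : ∀ g x, t (γ.act g x) = shiftAct V g (t x) := fun g x =>
    Subtype.ext (itinerary_act hγ p g x)
  let W : MulSubshift C G := itinerarySubshift hγ hp
  have hWt : ∀ v : V.carrier, v.1 ∈ W.carrier ↔ v ∈ range t := by
    intro v
    exact ⟨fun ⟨x, hx⟩ => ⟨x, Subtype.ext hx⟩, fun ⟨x, hx⟩ => ⟨x, congrArg Subtype.val hx⟩⟩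
  have himg : (ψ.image W).carrier = range fun x => (ψ.toFun (t x)).1 := by
    ext y
    constructor
    · rintro ⟨v, hv, rfl⟩
      obtain ⟨x, rfl⟩ := (hWt v).1 hv
      exact ⟨x, rfl⟩
    · rintro ⟨x, rfl⟩
      exact ⟨t x, (hWt _).2 ⟨x, rfl⟩, rfl⟩
  have hsub : (ψ.image W).carrier ⊆ Y.carrier := by
    rintro _ ⟨v, -, rfl⟩
    exact (ψ.toFun v).2
  have heq : (ψ.image W).carrier = Y.carrier := by
    by_contra hne
    refine hmin ⟨ψ.image W, ?_, hsub.ssubset_of_ne hne, ?_⟩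
    · rw [himg]
      exact range_nonempty _
    · rintro _ ⟨D, hD, rfl⟩
      obtain ⟨v, hv⟩ : D.Nonempty := nonempty_iff_ne_empty.2 fun h => hP.1.1 (h ▸ hD)
      obtain ⟨x, hx⟩ := hrange.ge ⟨v, rfl⟩
      have hxv : c (t x) = c v := hF₂ _ _ fun i hi => congrFun hx ⟨i, h2 hi⟩
      have hvD : D = c v := hcu v D ⟨hD, hv⟩
      refine ⟨(ψ.toFun (t x)).1, himg ▸ ⟨x, rfl⟩, t x, ?_, rfl⟩
      rw [hvD, ← hxv]
      exact (hc (t x)).2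
  have hlab : σ ∘ windowAt γ.act p F = (fun v : V.carrier => π ((ψ.toFun v).1 1)) ∘ t :=
    funext fun x => hσ' (t x)
  have hit : ∀ x, itinerary γ.act (σ ∘ windowAt γ.act p F) x = π ∘ (ψ.toFun (t x)).1 := by
    intro x
    rw [hlab, itinerary_comp ht, ← itinerary_shiftAct ψ]
    rfl
  rw [← heq, himg, ← range_comp]
  exact congrArg range (funext hit)

/-- The actions for which the labelling `p` is computed from windows with isolating patterns. -/
def isolatedSet (p : CantorSp → ℕ) : Set (ActionSpace G) :=
  {α | ∃ (n : ℕ) (r : CantorSp → Fin n) (F : Finset G) (σ : (F → Fin n) → ℕ), Continuous r ∧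
    p = σ ∘ windowAt α.act r F ∧ IsIsolating F (range (windowAt α.act r F)) σ}

theorem isOpen_isolatedSet (p : CantorSp → ℕ) : IsOpen (isolatedSet (G := G) p) := by
  rw [isOpen_iff_mem_nhds]
  rintro α ⟨n, r, F, σ, hr, hp, hiso⟩
  filter_upwards [(α.isOpen_setOf_windowAt_eq hr F).mem_nhds fun _ => rfl] with β hβ
  have : windowAt β.act r F = windowAt α.act r F := funext hβ
  exact ⟨n, r, F, σ, hr, by rw [this, hp], by rwa [this]⟩

/-- The actions for which `q` can be computed by the rule `τ` from a labelling with set of window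
patterns `𝓕`. -/
def extensionSet {n : ℕ} (q : CantorSp → ℕ) (F : Finset G) (𝓕 : Set (F → Fin n))
    (τ : (F → Fin n) → ℕ) : Set (ActionSpace G) :=
  {β | ∃ r : CantorSp → Fin n, Continuous r ∧ q = τ ∘ windowAt β.act r F ∧
    range (windowAt β.act r F) = 𝓕}

theorem isOpen_extensionSet {n : ℕ} (q : CantorSp → ℕ) (F : Finset G) (𝓕 : Set (F → Fin n))
    (τ : (F → Fin n) → ℕ) : IsOpen (extensionSet q F 𝓕 τ) := by
  rw [isOpen_iff_mem_nhds]
  rintro α ⟨r, hr, hq, h𝓕⟩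
  filter_upwards [(α.isOpen_setOf_windowAt_eq hr F).mem_nhds fun _ => rfl] with β hβ
  have : windowAt β.act r F = windowAt α.act r F := funext hβ
  exact ⟨r, hr, by rw [this, hq], by rwa [this]⟩

/-- Amalgamation: if `q` has the same itineraries under `β` as a labelling computed from `r` under
`α`, then the fibre product of the two actions over the common subshift of itineraries is a factor
of actions arbitrarily close to `β`, and it carries a copy of `r` from which `q` is computed. -/
theorem mem_closure_extensionSet [Countable G] {α β : ActionSpace G} {n : ℕ}
    {r : CantorSp → Fin n} (hr : Continuous r) {q : CantorSp → ℕ} (hq : Continuous q)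
    {F : Finset G} {τ : (F → Fin n) → ℕ}
    (h : range (itinerary α.act (τ ∘ windowAt α.act r F)) = range (itinerary β.act q)) :
    β ∈ closure (extensionSet q F (range (windowAt α.act r F)) τ) := by
  classical
  have hα := α.isContinuousAction
  have hβ := β.isContinuousAction
  rw [mem_closure_iff_nhds]
  intro U hU
  obtain ⟨k₀, F₀, hU'⟩ := ActionSpace.exists_windowAt_of_mem_nhds hU
  obtain ⟨k₁, hk₁⟩ := exists_eq_comp_firstBits hq
  let k := max k₀ k₁
  obtain ⟨π, hπ⟩ : ∃ π : (Fin k → Bool) → ℕ, q = π ∘ firstBits k := hk₁ _ (le_max_right _ _)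
  set p : CantorSp → ℕ := τ ∘ windowAt α.act r F with hp_def
  have hp : Continuous p := continuous_of_discreteTopology.comp (continuous_windowAt hα hr F)
  let S : Set (CantorSp × CantorSp) := {z | itinerary α.act p z.1 = itinerary β.act q z.2}
  have hS : IsClosed S := isClosed_eq ((continuous_itinerary hα hp).comp continuous_fst)
    ((continuous_itinerary hβ hq).comp continuous_snd)
  have : CompactSpace S := isCompact_iff_compactSpace.1 hS.isCompact
  let a : G → S → S := fun g z => ⟨(α.act g z.1.1, β.act g z.1.2), by
    show itinerary _ _ _ = itinerary _ _ _
    rw [itinerary_act hα, itinerary_act hβ]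
    exact congrArg (leftShift g) z.2⟩
  have ha : IsContinuousAction a :=
    { one := fun z => Subtype.ext (Prod.ext (hα.one _) (hβ.one _))
      mul := fun g h z => Subtype.ext (Prod.ext (hα.mul _ _ _) (hβ.mul _ _ _))
      continuous := fun g => by
        have := hα.continuous g
        have := hβ.continuous g
        exact Continuous.subtype_mk (by fun_prop) _ }
  let pr₁ : S → CantorSp := fun z => z.1.1
  let pr₂ : S → CantorSp := fun z => z.1.2
  have hpr₁ : Function.Surjective pr₁ := fun x => by
    obtain ⟨y, hy⟩ := h.le ⟨x, rfl⟩
    exact ⟨⟨(x, y), hy.symm⟩, rfl⟩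
  have hpr₂ : Function.Surjective pr₂ := fun y => by
    obtain ⟨x, hx⟩ := h.ge ⟨y, rfl⟩
    exact ⟨⟨(x, y), hx⟩, rfl⟩
  have hc₁ : Continuous pr₁ := continuous_fst.comp continuous_subtype_val
  have hc₂ : Continuous pr₂ := continuous_snd.comp continuous_subtype_val
  obtain ⟨γ, s, hs, hsurj, hse, hsp, hγ⟩ := exists_action_near_with_factor ha
    ((continuous_firstBits k).comp hc₂) β (continuous_firstBits k) (Finset.mem_insert_self 1 F₀)
    (range_windowAt_comp (b := β.act) (fun _ _ => rfl) hpr₂ _ _)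
  refine ⟨γ, hU' k _ (le_max_left _ _) (Finset.subset_insert _ _) γ hγ, r ∘ pr₁ ∘ s,
    hr.comp (hc₁.comp hs), funext fun x => ?_, ?_⟩
  · have hγr : windowAt γ.act (r ∘ pr₁ ∘ s) F x = windowAt α.act r F (pr₁ (s x)) :=
      windowAt_comp (b := α.act) (fun g x => congrArg pr₁ (hse g x)) _ _ _
    have h1 : p (pr₁ (s x)) = q (pr₂ (s x)) := by
      have := congrFun (s x).2 1
      rwa [itinerary_one hα, itinerary_one hβ] at this
    rw [Function.comp_apply, hγr]
    have h2 : firstBits k (pr₂ (s x)) = firstBits k x := hsp x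
    calc q x = π (firstBits k x) := congrFun hπ x
      _ = q (pr₂ (s x)) := by rw [← h2]; exact (congrFun hπ _).symm
      _ = _ := h1.symm
  · exact range_windowAt_comp (b := α.act) (fun g x => congrArg pr₁ (hse g x))
      (hpr₁.comp hsurj) _ _

/-- The density of isolated subshifts near every subshift of finite type. -/
def HasDenseIsolatedSubshifts (G : Type*) [Group G] : Prop :=
  ∀ (A : Type) [TopologicalSpace A] [DiscreteTopology A] [Finite A] [Nontrivial A]
    (X : MulSubshift A G) (N : Set (MulSubshift A G)), IsSFT X → IsOpen N → X ∈ N →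
    ∃ Y : MulSubshift A G, Y.carrier ⊆ X.carrier ∧ Y ∈ N ∧
      ∃ (C : Type) (_ : TopologicalSpace C) (_ : DiscreteTopology C) (_ : Finite C)
        (V : MulSubshift C G) (ψ : SubshiftMap V Y) (P : Set (Set V.carrier)),
        IsSFT V ∧ ψ.IsFactorMap ∧ IsClopenPartition V P ∧
        IsMinimalFor Y ((fun p : Set V.carrier => (fun v => (ψ.toFun v : G → A)) '' p) '' P)

/-- Containing every pattern from a given set is an open condition on subshifts. -/
theorem isOpen_setOf_patterns {A : Type*} [TopologicalSpace A] [DiscreteTopology A] [Finite A]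
    (F : Finset G) (𝓕 : Set (F → A)) :
    IsOpen {Y : MulSubshift A G | ∀ c ∈ 𝓕, ∃ y ∈ Y.carrier, (fun f : F => y f) = c} := by
  have : {Y : MulSubshift A G | ∀ c ∈ 𝓕, ∃ y ∈ Y.carrier, (fun f : F => y f) = c} =
      ⋂ c ∈ 𝓕, MulSubshift.carrier ⁻¹'
        {S : Set (G → A) | (S ∩ (fun (y : G → A) (f : F) => y f) ⁻¹' {c}).Nonempty} := by
    ext Y
    simp only [mem_iInter]
    rfl
  rw [this]
  let _ : TopologicalSpace (Set (G → A)) := TopologicalSpace.vietoris (G → A)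
  refine 𝓕.toFinite.isOpen_biInter fun c _ => isOpen_induced
    (f := (MulSubshift.carrier : MulSubshift A G → Set (G → A))) ?_
  exact TopologicalSpace.vietoris.isOpen_inter_nonempty_of_isOpen
    ((isOpen_discrete {c}).preimage (continuous_pi fun f => continuous_apply _))

/-- Near `α`, the labelling `p` is coarser than `firstBits k`. The windows of the latter define a
subshift of finite type, near which there is an isolated subshift `Y`, a factor of `V`. An action
near `α` that factors onto `V` carries a labelling with isolating patterns from which `p` is
computed. -/
theorem dense_isolatedSet [Countable G] (H : HasDenseIsolatedSubshifts G) {p : CantorSp → ℕ}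
    (hp : Continuous p) : Dense (isolatedSet (G := G) p) := by
  classical
  intro α
  rw [mem_closure_iff_nhds]
  intro U hU
  have hα := α.isContinuousAction
  obtain ⟨k₀, F₀, hU'⟩ := ActionSpace.exists_windowAt_of_mem_nhds hU
  obtain ⟨k₁, hk₁⟩ := exists_eq_comp_firstBits hp
  -- the successor makes the alphabet non-trivial
  set k := max k₀ k₁ + 1 with hk
  obtain ⟨π, hπ⟩ := hk₁ k (by omega)
  set F := insert 1 F₀
  have hr := continuous_firstBits k
  obtain ⟨Y, hYX, hYN, C, _, _, _, V, ψ, P, hV, hψ, hP, hmin⟩ := H (Fin k → Bool)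
    (ofPatterns F (range (windowAt α.act (firstBits k) F))) _ (isSFT_ofPatterns F _)
    (isOpen_setOf_patterns F (range (windowAt α.act (firstBits k) F))) (by
      rintro _ ⟨x, rfl⟩
      exact ⟨itinerary α.act (firstBits k) x,
        itinerary_mem_of_range_windowAt_subset hα subset_rfl x, rfl⟩)
  obtain ⟨F', σ, hσ, hiso⟩ := exists_window_of_isMinimalFor ψ hV hP hmin π
  have : CompactSpace V.carrier := isCompact_iff_compactSpace.1 V.isClosed.isCompact
  have hwin : ∀ v : V.carrier, windowAt (shiftAct V) (fun v => (ψ.toFun v).1 1) F v =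
      fun f : F => (ψ.toFun v).1 f := fun v =>
    funext fun f => congrFun (itinerary_shiftAct ψ v) f
  obtain ⟨γ, s, hs, hsurj, hse, hsp, hγ⟩ := exists_action_near_with_factor
    (isContinuousAction_shiftAct V) (q := fun v => (ψ.toFun v).1 1)
    ((continuous_apply 1).comp (continuous_subtype_val.comp ψ.continuous_toFun)) α hr
    (Finset.mem_insert_self 1 F₀) (by
      ext c
      constructor
      · rintro ⟨v, rfl⟩
        rw [hwin]
        have := hYX (ψ.toFun v).2 1
        rwa [leftShift_one] at this
      · intro hc
        obtain ⟨y, hy, hyc⟩ := hYN c hc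
        obtain ⟨v, hv⟩ := hψ ⟨y, hy⟩
        refine ⟨v, ?_⟩
        rw [hwin, hv, ← hyc])
  obtain ⟨n, ⟨e⟩⟩ := Finite.exists_equiv_fin C
  let r : CantorSp → C := fun x => (s x).1 1
  have hrc : Continuous r := (continuous_apply 1).comp (continuous_subtype_val.comp hs)
  have hrw : ∀ x, windowAt γ.act r F' x = fun f : F' => (s x).1 f := fun x => by
    have h := windowAt_comp (a := γ.act) (b := shiftAct V) hse (fun v => v.1 1) F' x
    refine h.trans (funext fun f => ?_)
    exact congrFun (itinerary_shiftAct_one (s x)) f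
  have hrange : range (windowAt γ.act r F') = range fun (v : V.carrier) (f : F') => v.1 f := by
    rw [← hsurj.range_comp]
    exact congrArg range (funext hrw)
  refine ⟨γ, hU' k F (by omega) (Finset.subset_insert _ _) γ hγ, n, e ∘ r, F',
    fun w => σ (e.symm ∘ w), continuous_of_discreteTopology.comp hrc, funext fun x => ?_, ?_⟩
  · have h1 : e.symm ∘ windowAt γ.act (e ∘ r) F' x = windowAt γ.act r F' x :=
      funext fun f => e.symm_apply_apply _
    rw [Function.comp_apply, h1, hrw, hσ, hπ]
    exact congrArg π (hsp x).symm
  · have key : ∀ (γ₁ : ActionSpace G) (p₁ : CantorSp → Fin n), Continuous p₁ →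
        range (windowAt γ₁.act p₁ F') = range (windowAt γ.act (e ∘ r) F') →
        range (itinerary γ₁.act ((fun w => σ (e.symm ∘ w)) ∘ windowAt γ₁.act p₁ F')) =
          (fun y => π ∘ y) '' Y.carrier := by
      intro γ₁ p₁ hp₁ h₁
      refine hiso γ₁ (e.symm ∘ p₁) (continuous_of_discreteTopology.comp hp₁) ?_
      have h2 := congrArg (fun S => (fun w : F' → Fin n => e.symm ∘ w) '' S) h₁
      simp only [← range_comp] at h2
      rw [← hrange]
      refine h2.trans (congrArg range (funext fun x => funext fun f => ?_))
      exact e.symm_apply_apply _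
    intro γ₁ γ₂ p₁ p₂ hp₁ hp₂ h₁ h₂
    rw [key γ₁ p₁ hp₁ h₁, key γ₂ p₂ hp₂ h₂]

/-- The actions that are generic for the construction of conjugacies: all labellings are isolated,
and labellings extend along isolated labellings whenever this is possible nearby. -/
def IsGenericAction (α : ActionSpace G) : Prop :=
  ∀ q : CantorSp → ℕ, Continuous q → α ∈ isolatedSet q ∧
    ∀ (n : ℕ) (F : Finset G) (𝓕 : Set (F → Fin n)) (τ : (F → Fin n) → ℕ),
      α ∈ closure (extensionSet q F 𝓕 τ) → α ∈ extensionSet q F 𝓕 τ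

theorem residual_isGenericAction [Countable G] (H : HasDenseIsolatedSubshifts G) :
    {α : ActionSpace G | IsGenericAction α} ∈ residual (ActionSpace G) := by
  have h1 : ∀ z : (Σ k, (Fin k → Bool) → ℕ),
      isolatedSet (G := G) (z.2 ∘ firstBits z.1) ∈ residual (ActionSpace G) := fun z =>
    residual_of_dense_open (isOpen_isolatedSet _)
      (dense_isolatedSet H (continuous_of_discreteTopology.comp (continuous_firstBits _)))
  have h2 : ∀ z : (Σ k, (Fin k → Bool) → ℕ) ×
      (Σ n, Σ F : Finset G, Set (F → Fin n) × ((F → Fin n) → ℕ)),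
      extensionSet (z.1.2 ∘ firstBits z.1.1) z.2.2.1 z.2.2.2.1 z.2.2.2.2 ∪
        (closure (extensionSet (z.1.2 ∘ firstBits z.1.1) z.2.2.1 z.2.2.2.1 z.2.2.2.2))ᶜ ∈
      residual (ActionSpace G) := by
    intro z
    refine residual_of_dense_open
      ((isOpen_extensionSet _ _ _ _).union isClosed_closure.isOpen_compl) fun α => ?_
    rw [closure_union]
    by_cases h : α ∈ closure (extensionSet (z.1.2 ∘ firstBits z.1.1) z.2.2.1 z.2.2.2.1 z.2.2.2.2)
    · exact Or.inl h
    · exact Or.inr (subset_closure h)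
  filter_upwards [(countable_iInter_mem (l := residual (ActionSpace G))).2 h1,
    (countable_iInter_mem (l := residual (ActionSpace G))).2 h2] with α hα1 hα2 q hq
  obtain ⟨k, hk⟩ := exists_eq_comp_firstBits hq
  obtain ⟨f, rfl⟩ := hk k le_rfl
  refine ⟨mem_iInter.1 hα1 ⟨k, f⟩, fun n F 𝓕 τ h => ?_⟩
  exact (mem_iInter.1 hα2 (⟨k, f⟩, ⟨n, F, 𝓕, τ⟩)).resolve_right fun h' => h' h

/-- The extension step of the back-and-forth between generic actions. -/
theorem IsGenericAction.exists_refinement [Countable G] {α β : ActionSpace G}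
    (hα : IsGenericAction α) (hβ : IsGenericAction β) {p q : C(CantorSp, ℕ)}
    (hpq : range (itinerary α.act p) = range (itinerary β.act q)) (p' : C(CantorSp, ℕ))
    (π : ℕ → ℕ) (hp' : ∀ x, p x = π (p' x)) :
    ∃ q' : C(CantorSp, ℕ), range (itinerary α.act p') = range (itinerary β.act q') ∧
      ∀ y, q y = π (q' y) := by
  obtain ⟨n, r, F, σ, hr, hp'r, hiso⟩ := (hα p' p'.continuous).1
  have hpr : (p : CantorSp → ℕ) = (π ∘ σ) ∘ windowAt α.act r F := by
    rw [Function.comp_assoc, ← hp'r]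
    exact funext hp'
  rw [hpr] at hpq
  obtain ⟨r', hr', hq, h𝓕⟩ := (hβ q q.continuous).2 n F _ _
    (mem_closure_extensionSet hr q.continuous hpq)
  refine ⟨⟨σ ∘ windowAt β.act r' F, continuous_of_discreteTopology.comp
    (continuous_windowAt β.isContinuousAction hr' F)⟩, ?_, fun y => congrFun hq y⟩
  rw [hp'r]
  exact hiso α β r r' hr hr' rfl h𝓕

/-- Any two generic actions are conjugate, by back-and-forth. -/
theorem IsGenericAction.exists_conj_eq [Countable G] {α β : ActionSpace G}
    (hα : IsGenericAction α) (hβ : IsGenericAction β) :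
    ∃ φ : CantorSp ≃ₜ CantorSp, ActionSpace.conj φ α = β := by
  have key := exists_homeomorph_of_backAndForth (fun g => α.act g⁻¹) (fun g => β.act g⁻¹)
    (fun g => α.isContinuousAction.continuous _) (fun g => β.isContinuousAction.continuous _)
    1 (fun x => by rw [inv_one, α.isContinuousAction.one])
    (fun x => by rw [inv_one, β.isContinuousAction.one])
    (fun p q => range (itinerary α.act p) = range (itinerary β.act q))
    (fun p q h => h)
    (fun p q p' π hpq hp' => hα.exists_refinement hβ hpq p' π hp')
    (fun p q q' π hpq hq' => by
      obtain ⟨p', h1, h2⟩ := hβ.exists_refinement hα hpq.symm q' π hq'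
      exact ⟨p', h1.symm, h2⟩)
    (ContinuousMap.const _ 0) (ContinuousMap.const _ 0) (by
      have h1 : ∀ γ : ActionSpace G,
          range (itinerary γ.act (ContinuousMap.const CantorSp (0 : ℕ))) = {fun _ => 0} :=
        fun γ => range_const (ι := CantorSp) (c := fun _ : G => (0 : ℕ))
      rw [h1, h1])
  obtain ⟨h, -, hh⟩ := key
  refine ⟨h, ActionSpace.ext_act fun g x => ?_⟩
  obtain ⟨y, rfl⟩ := h.surjective x
  have := hh g⁻¹ y
  rw [inv_inv] at this
  rw [ActionSpace.act_conj, this]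

theorem HasDenseIsolatedSubshifts.hasSTRP [Countable G] (H : HasDenseIsolatedSubshifts G) :
    HasSTRP G := by
  have hres := residual_isGenericAction H
  obtain ⟨α, hα⟩ := (dense_of_mem_residual hres).nonempty
  refine ⟨α, Filter.mem_of_superset hres fun β hβ => ?_⟩
  exact IsGenericAction.exists_conj_eq hα hβ

end Isolation

/-! ### Isolated subshifts from a comeager conjugacy class -/

section Comeager

variable {G : Type*} [Group G]

/-- The identity map of a subshift. -/
def SubshiftMap.id {A : Type*} [TopologicalSpace A] (X : MulSubshift A G) : SubshiftMap X X where
  toFun := _root_.id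
  continuous_toFun := continuous_id
  equivariant _ _ := rfl

theorem SubshiftMap.isFactorMap_id {A : Type*} [TopologicalSpace A] (X : MulSubshift A G) :
    (SubshiftMap.id X).IsFactorMap :=
  Function.surjective_id

theorem SubshiftMap.image_id {A : Type*} [TopologicalSpace A] [Finite A] [T2Space A]
    {X Y : MulSubshift A G} (h : Y.carrier ⊆ X.carrier) : (SubshiftMap.id X).image Y = Y := by
  have : ((SubshiftMap.id X).image Y).carrier = Y.carrier := by
    ext y
    constructor
    · rintro ⟨x, hx, rfl⟩
      exact hx
    · intro hy
      exact ⟨⟨y, h hy⟩, hy, rfl⟩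
  cases Y
  exact (MulSubshift.mk.injEq ..).mpr this

/-- A subshift of `Z` with sufficiently many of the patterns of `Z` has image close to that of
`Z`. -/
theorem exists_finset_image_mem {A B : Type*} [TopologicalSpace A] [T2Space A] [TopologicalSpace B]
    [DiscreteTopology B] [Finite B] {X : MulSubshift A G} {Z : MulSubshift B G}
    {φ : SubshiftMap Z X} (hφ : φ.IsFactorMap) {N : Set (MulSubshift A G)} (hN : IsOpen N)
    (hX : X ∈ N) :
    ∃ F : Finset G, ∀ Y : MulSubshift B G,
      (∀ z ∈ Z.carrier, ∃ y ∈ Y.carrier, y ∈ Z.carrier ∧ ∀ g ∈ F, y g = z g) → φ.image Y ∈ N := by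
  classical
  let _ : TopologicalSpace (Set (G → A)) := TopologicalSpace.vietoris (G → A)
  obtain ⟨T, hT, rfl⟩ := (isOpen_induced_iff
    (f := (MulSubshift.carrier : MulSubshift A G → Set (G → A)))).1 hN
  replace hT : TopologicalSpace.GenerateOpen _ T := hT
  replace hX : X.carrier ∈ T := hX
  suffices ∃ F : Finset G, ∀ Y : MulSubshift B G,
      (∀ z ∈ Z.carrier, ∃ y ∈ Y.carrier, y ∈ Z.carrier ∧ ∀ g ∈ F, y g = z g) →
        (φ.image Y).carrier ∈ T from this
  clear hN
  revert hX
  induction hT with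
  | basic T hT =>
    intro hX
    rcases hT with h | h
    · obtain ⟨U, -, rfl⟩ := h
      refine ⟨∅, fun Y _ => ?_⟩
      rintro _ ⟨z, -, rfl⟩
      exact hX (φ.toFun z).2
    · obtain ⟨U, hU, rfl⟩ := h
      obtain ⟨x, hx, hxU⟩ := hX
      obtain ⟨z, hz⟩ := hφ ⟨x, hx⟩
      have hopen : IsOpen {z : Z.carrier | (φ.toFun z).1 ∈ U} :=
        IsOpen.preimage (continuous_subtype_val.comp φ.continuous_toFun) hU
      obtain ⟨O, hO, hOU⟩ := isOpen_induced_iff.1 hopen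
      have hzU : z ∈ {z : Z.carrier | (φ.toFun z).1 ∈ U} := by
        show (φ.toFun z).1 ∈ U
        rwa [hz]
      have hzO : z.1 ∈ O := by
        rw [← hOU] at hzU
        exact hzU
      obtain ⟨I, u, hu, hIu⟩ := isOpen_pi_iff.1 hO z.1 hzO
      refine ⟨I, fun Y hY => ?_⟩
      obtain ⟨y, hy, hyZ, hyz⟩ := hY z.1 z.2
      refine ⟨(φ.toFun ⟨y, hyZ⟩).1, ⟨⟨y, hyZ⟩, hy, rfl⟩, ?_⟩
      have : (⟨y, hyZ⟩ : Z.carrier) ∈ Subtype.val ⁻¹' O := hIu fun i hi => by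
        show y i ∈ u i
        rw [hyz i hi]
        exact (hu i hi).2
      rw [hOU] at this
      exact this
  | univ => exact fun _ => ⟨∅, fun _ _ => mem_univ _⟩
  | inter S T _ _ ihS ihT =>
    intro hX
    obtain ⟨F₁, h₁⟩ := ihS hX.1
    obtain ⟨F₂, h₂⟩ := ihT hX.2
    refine ⟨F₁ ∪ F₂, fun Y hY => ⟨h₁ Y fun z hz => ?_, h₂ Y fun z hz => ?_⟩⟩
    · obtain ⟨y, hy, hyZ, h⟩ := hY z hz
      exact ⟨y, hy, hyZ, fun g hg => h g (Finset.mem_union_left _ hg)⟩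
    · obtain ⟨y, hy, hyZ, h⟩ := hY z hz
      exact ⟨y, hy, hyZ, fun g hg => h g (Finset.mem_union_right _ hg)⟩
  | sUnion 𝒯 _ ih =>
    rintro ⟨T, hT, hXT⟩
    obtain ⟨F, hF⟩ := ih T hT hXT
    exact ⟨F, fun Y hY => ⟨T, hT, hF Y hY⟩⟩

theorem mem_of_forall_finset {ι A : Type*} [TopologicalSpace A] {S : Set (ι → A)}
    (hS : IsClosed S) {y : ι → A} (h : ∀ F : Finset ι, ∃ x ∈ S, ∀ i ∈ F, x i = y i) : y ∈ S := by
  rw [← hS.closure_eq, mem_closure_iff]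
  intro O hO hy
  obtain ⟨I, u, hu, hIu⟩ := isOpen_pi_iff.1 hO y hy
  obtain ⟨x, hx, hxy⟩ := h I
  refine ⟨x, hIu fun i hi => ?_, hx⟩
  rw [hxy i hi]
  exact (hu i hi).2

theorem range_itinerary_conj {B : Type*} (α : ActionSpace G) (q : CantorSp → B)
    (h : CantorSp ≃ₜ CantorSp) :
    range (itinerary (ActionSpace.conj h α).act q) = range (itinerary α.act (q ∘ h)) :=
  (range_itinerary_comp (fun g x => (ActionSpace.act_conj h α g x).symm) h.surjective q).symm

/-- The subshift of itineraries depends continuously on the action. -/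
theorem range_itinerary_eq_of_mem_closure {B : Type*} [TopologicalSpace B] [DiscreteTopology B]
    {q : CantorSp → B} (hq : Continuous q) {E : Set (ActionSpace G)} {S : Set (G → B)}
    (hS : IsClosed S) (hE : ∀ γ ∈ E, range (itinerary γ.act q) = S) {β : ActionSpace G}
    (hβ : β ∈ closure E) : range (itinerary β.act q) = S := by
  have near : ∀ F : Finset G, ∃ γ ∈ E, ∀ x, ∀ g ∈ F,
      itinerary γ.act q x g = itinerary β.act q x g := by
    intro F
    obtain ⟨γ, hγ, hγE⟩ := mem_closure_iff.1 hβ _ (β.isOpen_setOf_windowAt_eq hq F) fun _ => rfl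
    exact ⟨γ, hγE, fun x g hg => congrFun (hγ x) ⟨g, hg⟩⟩
  apply Subset.antisymm
  · rintro _ ⟨x, rfl⟩
    refine mem_of_forall_finset hS fun F => ?_
    obtain ⟨γ, hγE, hγ⟩ := near F
    exact ⟨_, (hE γ hγE).le ⟨x, rfl⟩, hγ x⟩
  · intro y hy
    refine mem_of_forall_finset
      (isCompact_range (continuous_itinerary β.isContinuousAction hq)).isClosed fun F => ?_
    obtain ⟨γ, hγE, hγ⟩ := near F
    obtain ⟨x, rfl⟩ := (hE γ hγE).ge hy
    exact ⟨_, ⟨x, rfl⟩, fun g hg => (hγ x g hg).symm⟩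

/-- If some conjugacy class is comeager, then every open set of actions contains an action near
which the subshift of itineraries of the labelling `q` is constant: the conjugacy class is the union
of countably many pieces, indexed by the labellings `q ∘ h`, on each of which this subshift is
constant, so that one of the pieces is dense near one of its points in the open set. -/
theorem HasSTRP.exists_locally_constant [Countable G] (H : HasSTRP G) {B : Type*}
    [TopologicalSpace B] [DiscreteTopology B] [Finite B] {q : CantorSp → B} (hq : Continuous q)
    {U : Set (ActionSpace G)} (hU : IsOpen U) (hne : U.Nonempty) :
    ∃ β ∈ U, ∃ U' ∈ 𝓝 β, ∀ γ ∈ U', range (itinerary γ.act q) = range (itinerary β.act q) := by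
  obtain ⟨α, hα⟩ := H
  let E : (Σ k, (Fin k → Bool) → B) → Set (ActionSpace G) := fun z =>
    {γ | ∃ h : CantorSp ≃ₜ CantorSp, q ∘ h = z.2 ∘ firstBits z.1 ∧ ActionSpace.conj h α = γ}
  have hres : ∀ z, interior (closure (E z)) ∪ (closure (E z))ᶜ ∈ residual (ActionSpace G) := by
    intro z
    refine residual_of_dense_open (isOpen_interior.union isClosed_closure.isOpen_compl) ?_
    rw [← compl_sdiff, ← isClosed_closure.frontier_eq, ← interior_eq_empty_iff_dense_compl]
    exact interior_frontier isClosed_closure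
  obtain ⟨β, hβU, ⟨h, hβ⟩, hβE⟩ := (dense_of_mem_residual
    (Filter.inter_mem hα ((countable_iInter_mem (l := residual (ActionSpace G))).2 hres))
    ).inter_open_nonempty U hU hne
  obtain ⟨k, hk⟩ := exists_eq_comp_firstBits (hq.comp h.continuous)
  obtain ⟨f, hf⟩ := hk k le_rfl
  have hβmem : β ∈ E ⟨k, f⟩ := ⟨h, hf, hβ⟩
  have hint : β ∈ interior (closure (E ⟨k, f⟩)) :=
    (mem_iInter.1 hβE ⟨k, f⟩).resolve_right fun h' => h' (subset_closure hβmem)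
  refine ⟨β, hβU, _, isOpen_interior.mem_nhds hint, fun γ hγ => ?_⟩
  refine range_itinerary_eq_of_mem_closure hq
    (isCompact_range (continuous_itinerary β.isContinuousAction hq)).isClosed ?_
    (interior_subset hγ)
  rintro _ ⟨h', hh', rfl⟩
  rw [range_itinerary_conj, hh', ← hβ, range_itinerary_conj, hf]

/-- Every non-empty subshift is the subshift of itineraries of an action on the Cantor space. -/
theorem exists_action_factor [Countable G] {B : Type*} [TopologicalSpace B] [DiscreteTopology B]
    [Finite B] (Z : MulSubshift B G) (hZ : Z.carrier.Nonempty) :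
    ∃ (α : ActionSpace G) (q : CantorSp → B), Continuous q ∧
      range (itinerary α.act q) = Z.carrier := by
  have : CompactSpace Z.carrier := isCompact_iff_compactSpace.1 Z.isClosed.isCompact
  have : Nonempty Z.carrier := hZ.to_subtype
  have hZa := isContinuousAction_shiftAct Z
  obtain ⟨α₀⟩ : Nonempty (ActionSpace G) := inferInstance
  obtain ⟨α, s, hs, hsurj, hse, -, -⟩ := exists_action_near_with_factor hZa
    (q := fun _ => ()) continuous_const α₀ (p := fun _ => ()) continuous_const
    (Finset.mem_singleton_self 1) ((range_nonempty _).eq_univ.trans (range_nonempty _).eq_univ.symm)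
  refine ⟨α, (fun v : Z.carrier => v.1 1) ∘ s, (continuous_apply 1).comp (continuous_subtype_val.comp hs), ?_⟩
  rw [range_itinerary_comp hse hsurj, funext itinerary_shiftAct_one, Subtype.range_coe]

/-- The subshift of the points of `V` sent to `Y` by `θ`. -/
def SubshiftMap.preimage {A C : Type*} [TopologicalSpace A] [TopologicalSpace C]
    {V : MulSubshift C G} {X : MulSubshift A G} (θ : SubshiftMap V X) (Y : MulSubshift A G) :
    MulSubshift C G where
  carrier := Subtype.val '' {v : V.carrier | (θ.toFun v).1 ∈ Y.carrier}
  isClosed := V.isClosed.isClosedEmbedding_subtypeVal.isClosedMap _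
    (Y.isClosed.preimage (continuous_subtype_val.comp θ.continuous_toFun))
  mapsTo := by
    rintro g _ ⟨v, hv, rfl⟩
    refine ⟨⟨leftShift g⁻¹ v.1, leftShift_mem V g⁻¹ v.2⟩, ?_, ?_⟩
    · show (θ.toFun _).1 ∈ Y.carrier
      rw [θ.equivariant]
      exact leftShift_mem Y g⁻¹ hv
    · show leftShift g⁻¹ v.1 = mulShift g v.1
      rw [leftShift, inv_inv]

/-- The itineraries of a labelling, near an action where they are locally constant, form an isolated
subshift of `Z`. -/
theorem HasSTRP.exists_minimal [Countable G] (H : HasSTRP G) {A B : Type}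
    [TopologicalSpace A] [DiscreteTopology A] [Finite A]
    [TopologicalSpace B] [DiscreteTopology B] [Finite B] [Nontrivial B]
    {X : MulSubshift A G} {Z : MulSubshift B G} {φ : SubshiftMap Z X}
    {N : Set (MulSubshift A G)} (hZ : IsSFT Z) (hφ : φ.IsFactorMap) (hN : IsOpen N) (hX : X ∈ N) :
    ∃ (Y : MulSubshift B G) (hYZ : Y.carrier ⊆ Z.carrier),
      IsSofic Y ∧ φ.image Y ∈ N ∧
      ∃ (C : Type) (_ : TopologicalSpace C) (_ : DiscreteTopology C) (_ : Finite C)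
        (_ : Nontrivial C) (V : MulSubshift C G) (ψ : SubshiftMap V Y)
        (P : Set (Set V.carrier)),
        IsSFT V ∧ ψ.IsFactorMap ∧ IsClopenPartition V P ∧
        IsMinimalFor (φ.image Y)
          ((fun p : Set V.carrier =>
            (fun v => (φ.toFun (Set.inclusion hYZ (ψ.toFun v)) : G → A)) '' p) '' P) := by
  classical
  obtain ⟨F₀, hF₀⟩ := exists_finset_image_mem hφ hN hX
  rcases Z.carrier.eq_empty_or_nonempty with hZe | hZne
  · have hid := SubshiftMap.isFactorMap_id Z
    refine ⟨Z, subset_rfl, ⟨B, _, ‹_›, ‹_›, ‹_›, Z, .id Z, hZ, hid⟩,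
      hF₀ Z fun z hz => ⟨z, hz, hz, fun _ _ => rfl⟩, B, _, ‹_›, ‹_›, ‹_›, Z, .id Z, ∅, hZ, hid,
      ⟨⟨notMem_empty _, fun z => ?_⟩, fun _ h => h.elim⟩, ?_⟩
    · exact absurd ⟨z.1, z.2⟩ (not_nonempty_iff_eq_empty.2 hZe)
    · rintro ⟨Y, ⟨y, hy⟩, hYZ, -⟩
      obtain ⟨z, hz, -⟩ := hYZ.1 hy
      exact absurd ⟨z.1, hz⟩ (not_nonempty_iff_eq_empty.2 hZe)
  obtain ⟨F₁, allowed, hF₁⟩ := id hZ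
  obtain ⟨α, q, hq, hαZ⟩ := exists_action_factor Z hZne
  -- near `α`, the itineraries of `q` stay in `Z` and have a large image
  obtain ⟨β, hβ, U', hU', hconst⟩ := H.exists_locally_constant hq
    (α.isOpen_setOf_windowAt_eq hq (F₀ ∪ F₁)) ⟨α, fun _ => rfl⟩
  have hβF : ∀ x, ∀ g ∈ F₀ ∪ F₁, itinerary β.act q x g = itinerary α.act q x g := fun x g hg =>
    congrFun (hβ x) ⟨g, hg⟩
  have hβa := β.isContinuousAction
  let Y : MulSubshift B G := itinerarySubshift hβa hq
  have hYZ : Y.carrier ⊆ Z.carrier := by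
    rintro _ ⟨x, rfl⟩
    rw [hF₁]
    refine itinerary_mem_of_range_windowAt_subset hβa ?_ x
    rintro _ ⟨y, rfl⟩
    have hy : itinerary α.act q y ∈ Z.carrier := hαZ.le ⟨y, rfl⟩
    have h1 := (hF₁ _).1 hy 1
    rw [leftShift_one] at h1
    convert h1 using 1
    exact funext fun f => hβF y f (Finset.mem_union_right _ f.2)
  have hYN : φ.image Y ∈ N := by
    refine hF₀ Y fun z hz => ?_
    obtain ⟨x, rfl⟩ := hαZ.ge hz
    have hx : itinerary β.act q x ∈ Y.carrier := ⟨x, rfl⟩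
    exact ⟨_, hx, hYZ hx, fun g hg => hβF x g (Finset.mem_union_left _ hg)⟩
  obtain ⟨k₀, F₂, hF₂⟩ := ActionSpace.exists_windowAt_of_mem_nhds hU'
  obtain ⟨k₁, hk₁⟩ := exists_eq_comp_firstBits hq
  -- the successor makes the alphabet non-trivial
  let k := max k₀ k₁ + 1
  obtain ⟨π, hπ⟩ : ∃ π : (Fin k → Bool) → B, q = π ∘ firstBits k :=
    hk₁ k ((le_max_right _ _).trans (Nat.le_succ _))
  have hk : k₀ ≤ k := (le_max_left _ _).trans (Nat.le_succ _)
  let F := insert 1 F₂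
  let 𝓕 : Set (F → Fin k → Bool) := range (windowAt β.act (firstBits k) F)
  let V : MulSubshift (Fin k → Bool) G := ofPatterns F 𝓕
  -- a subshift of `V` with all patterns is a factor of an action in the neighbourhood `U'` of `β`
  have key : ∀ W : MulSubshift (Fin k → Bool) G, W.carrier ⊆ V.carrier →
      (∀ c ∈ 𝓕, ∃ w ∈ W.carrier, (fun f : F => w f) = c) →
      (fun w => π ∘ w) '' W.carrier = Y.carrier := by
    intro W hWV hW
    have : CompactSpace W.carrier := isCompact_iff_compactSpace.1 W.isClosed.isCompact
    have hwin : ∀ w : W.carrier, windowAt (shiftAct W) (fun w => w.1 1) F w =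
        fun f : F => w.1 f := fun w => funext fun f => congrFun (itinerary_shiftAct_one w) f
    obtain ⟨γ, s, hs, hsurj, hse, hsp, hγ⟩ := exists_action_near_with_factor
      (isContinuousAction_shiftAct W) (q := fun w => w.1 1)
      ((continuous_apply 1).comp continuous_subtype_val) β (continuous_firstBits k)
      (Finset.mem_insert_self 1 F₂) (by
        ext c
        constructor
        · rintro ⟨w, rfl⟩
          rw [hwin]
          have := hWV w.2 1
          rwa [leftShift_one] at this
        · intro hc
          obtain ⟨w, hw, rfl⟩ := hW c hc
          exact ⟨⟨w, hw⟩, hwin _⟩)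
    have hγq := hconst γ (hF₂ k F hk (Finset.subset_insert _ _) γ hγ)
    have hqs : q = (fun w : W.carrier => π (w.1 1)) ∘ s := by
      rw [hπ]
      exact funext fun x => congrArg π (hsp x).symm
    have : (fun w => π ∘ w) '' W.carrier =
        range (itinerary (shiftAct W) fun w : W.carrier => π (w.1 1)) := by
      rw [image_eq_range]
      refine congrArg range (funext fun w => ?_)
      rw [← itinerary_shiftAct_one w]
      rfl
    rw [this, ← range_itinerary_comp hse hsurj, ← hqs]
    exact hγq
  have hβV : ∀ c ∈ 𝓕, ∃ v ∈ V.carrier, (fun f : F => v f) = c := by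
    rintro _ ⟨x, rfl⟩
    exact ⟨_, itinerary_mem_of_range_windowAt_subset hβa subset_rfl x, rfl⟩
  have hVY := key V subset_rfl hβV
  let ψ : SubshiftMap V Y :=
    { toFun := fun v => ⟨π ∘ v.1, hVY.le ⟨v.1, v.2, rfl⟩⟩
      continuous_toFun := (continuous_pi fun g => continuous_of_discreteTopology.comp
        ((continuous_apply g).comp continuous_subtype_val)).subtype_mk _
      equivariant := fun _ _ => rfl }
  have hψ : ψ.IsFactorMap := by
    rintro ⟨y, hy⟩
    obtain ⟨v, hv, rfl⟩ := hVY.ge hy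
    exact ⟨⟨v, hv⟩, rfl⟩
  have hV : IsSFT V := isSFT_ofPatterns F 𝓕
  let piece : (F → Fin k → Bool) → Set V.carrier := fun c => {v | (fun f : F => v.1 f) = c}
  refine ⟨Y, hYZ, ⟨_, _, inferInstance, inferInstance, inferInstance, V, ψ, hV, hψ⟩, hYN,
    _, _, inferInstance, inferInstance, inferInstance, V, ψ, piece '' 𝓕, hV, hψ,
    ⟨⟨?_, fun v => ⟨piece fun f => v.1 f, ⟨⟨_, ?_, rfl⟩, rfl⟩, ?_⟩⟩, ?_⟩, ?_⟩
  · rintro ⟨c, hc, hce⟩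
    obtain ⟨v, hv, hvc⟩ := hβV c hc
    have : (⟨v, hv⟩ : V.carrier) ∈ piece c := hvc
    rw [hce] at this
    exact this
  · have := v.2 1
    rwa [leftShift_one] at this
  · rintro _ ⟨⟨c, -, rfl⟩, hv⟩
    have hv : (fun f : F => v.1 f) = c := hv
    rw [hv]
  · rintro _ ⟨c, -, rfl⟩
    exact (isClopen_discrete {c}).preimage
      (continuous_pi fun f => (continuous_apply _).comp continuous_subtype_val)
  · rintro ⟨Y', -, hY', hmeet⟩
    let θ : SubshiftMap V X :=
      { toFun := fun v => φ.toFun (inclusion hYZ (ψ.toFun v))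
        continuous_toFun :=
          φ.continuous_toFun.comp ((continuous_inclusion hYZ).comp ψ.continuous_toFun)
        equivariant := fun g v => φ.equivariant g (inclusion hYZ (ψ.toFun v)) }
    have hW := key (θ.preimage Y') (by rintro _ ⟨v, -, rfl⟩; exact v.2) fun c hc => by
      obtain ⟨_, hx, v, hv, rfl⟩ := hmeet _ ⟨piece c, ⟨c, hc, rfl⟩, rfl⟩
      exact ⟨v.1, ⟨v, hx, rfl⟩, hv⟩
    refine hY'.2 ?_
    rintro _ ⟨z, hz, rfl⟩
    obtain ⟨_, ⟨v, hv, rfl⟩, hvz⟩ := hW.ge hz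
    have : inclusion hYZ (ψ.toFun v) = z := Subtype.ext hvz
    rw [← this]
    exact hv

end Comeager

end

theorem mainTheorem6 {G : Type*} [Group G] [Countable G] :
    HasSTRP G ↔
      ∀ (A B : Type) [TopologicalSpace A] [DiscreteTopology A] [Finite A] [Nontrivial A]
        [TopologicalSpace B] [DiscreteTopology B] [Finite B] [Nontrivial B]
        (X : MulSubshift A G) (Z : MulSubshift B G) (φ : SubshiftMap Z X)
        (N : Set (MulSubshift A G)),
        IsSofic X → IsSFT Z → φ.IsFactorMap → IsOpen N → X ∈ N →
        ∃ (Y : MulSubshift B G) (hYZ : Y.carrier ⊆ Z.carrier),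
          IsSofic Y ∧ φ.image Y ∈ N ∧
          ∃ (C : Type) (_ : TopologicalSpace C) (_ : DiscreteTopology C) (_ : Finite C)
            (_ : Nontrivial C) (V : MulSubshift C G) (ψ : SubshiftMap V Y)
            (P : Set (Set V.carrier)),
            IsSFT V ∧ ψ.IsFactorMap ∧ IsClopenPartition V P ∧
            IsMinimalFor (φ.image Y)
              ((fun p : Set V.carrier =>
                (fun v => (φ.toFun (Set.inclusion hYZ (ψ.toFun v)) : G → A)) '' p) '' P) := by
  constructor
  · intro H A B _ _ _ _ _ _ _ _ X Z φ N _ hZ hφ hN hX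
    exact H.exists_minimal hZ hφ hN hX
  · intro H
    refine HasDenseIsolatedSubshifts.hasSTRP fun A _ _ _ _ X N hX hN hXN => ?_
    obtain ⟨Y, hYX, -, hYN, C, i₁, i₂, i₃, -, V, ψ, P, hV, hψ, hP, hmin⟩ :=
      H A A X X (.id X) N ⟨A, _, ‹_›, ‹_›, ‹_›, X, .id X, hX, SubshiftMap.isFactorMap_id X⟩ hX
        (SubshiftMap.isFactorMap_id X) hN hXN
    rw [SubshiftMap.image_id hYX] at hYN hmin
    exact ⟨Y, hYX, hYN, C, i₁, i₂, i₃, V, ψ, P, hV, hψ, hP, hmin⟩
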